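/- Let $n,m,p\in\mathbb N$ and consider the plant $dx=(Ax+Bu)\,dt+dw$, $dy=Cx\,dt+dv$ with $x(t)\in\mathbb R^n$, $u(t)\in\mathbb R^m$, $y(t)\in\mathbb R^p$, where $w$ and $v$ are independent Brownian motions with covariance (intensity) matrices $W\succeq 0$ and $V\succ 0$, so that $\dot w,\dot v$ are independent white Gaussian noises. Let $Q\succeq0$, $R\succ0$, and assume that $(A,B)$ and $(A,W^{1/2})$ are controllable and $(C,A)$ and $(Q^{1/2},A)$ are observable. Identify a triple $\mathsf K=(A_{\mathsf K},B_{\mathsf K},C_{\mathsf K})\in\mathbb R^{n\times n}\times\mathbb R^{n\times p}\times\mathbb R^{m\times n}$ with the full-order controller $d\xi=A_{\mathsf K}\xi\,dt+B_{\mathsf K}\,dy$, $u=C_{\mathsf K}\xi$, and let $\mathcal C_n$ be the set of those $\mathsf K$ for which all eigenvalues of $\begin{bmatrix}A&BC_{\mathsf K}\\B_{\mathsf K}C&A_{\mathsf K}\end{bmatrix}$ have negative real part. Let the initial states $x(0),\xi(0)$ be any random vectors with finite second moments, and let $x,u$ be the resulting closed-loop state and input. Define the LQG cost $$J_n(\mathsf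 K)=\lim_{T\to\infty}\frac1T\,\mathbb E\int_0^T\bigl(x^{\mathsf T}Qx+u^{\mathsf T}Ru\bigr)\,dt .$$ For every $\mathsf K\in\mathcal C_n$ the expectation is finite for every $T>0$ and the limit $J_n(\mathsf K)$ exists in $\mathbb R$. Moreover, let $\mathsf K\in\mathcal C_n$ be a stationary point of $J_n$ (the derivative of $J_n$ with respect to $(A_{\mathsf K},B_{\mathsf K},C_{\mathsf K})$ at $\mathsf K$ is zero) that is minimal, i.e. $(A_{\mathsf K},B_{\mathsf K})$ is controllable and $(C_{\mathsf K},A_{\mathsf K})$ is observable. Then $\mathsf K$ is globally optimal, that is, $J_n(\mathsf K)\le J_n(\mathsf K')$ for all $\mathsf K'\in\mathcal C_n$, and there is an invertible $T\in\mathbb R^{n\times n}$ such that $$A_{\mathsf K}=T(A-BK-LC)T^{-1},\qquad B_{\mathsf K}=-TL,\qquad C_{\mathsf K}=KT^{-1},$$ where $K=R^{-1}B^{\mathsf T}S$, $L=PC^{\mathsf T}V^{-1}$, and $P$ and $S$ are the unique positive definite solutions of the Riccati equations $$AP+PA^{\mathsf T}-PC^{\mathsf T}V^{-1}CP+W=0,\qquad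 A^{\mathsf T}S+SA-SBR^{-1}B^{\mathsf T}S+Q=0 .$$ -/

import Mathlib

open MeasureTheory ProbabilityTheory Filter Topology
open scoped NNReal Matrix MatrixOrder

namespace LQG

noncomputable section

/-! ### Linear systems -/

/-- `(A, B)` is controllable: the matrix `[B, AB, …, A^{n-1}B]` has full row rank `n`. -/
def Controllable {n k : ℕ} (A : Matrix (Fin n) (Fin n) ℝ) (B : Matrix (Fin n) (Fin k) ℝ) : Prop :=
  (Matrix.of fun (i : Fin n) (lj : Fin n × Fin k) => (A ^ (lj.1 : ℕ) * B) i lj.2).rank = n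

/-- `(C, A)` is observable: the matrix with block rows `C, CA, …, CA^{n-1}` has full column
rank `n`. -/
def Observable {n k : ℕ} (C : Matrix (Fin k) (Fin n) ℝ) (A : Matrix (Fin n) (Fin n) ℝ) : Prop :=
  (Matrix.of fun (lj : Fin n × Fin k) (i : Fin n) => (C * A ^ (lj.1 : ℕ)) lj.2 i).rank = n

/-- All (complex) eigenvalues of the real matrix `M` have negative real part. -/
def IsStable {ι : Type*} [Fintype ι] [DecidableEq ι] (M : Matrix ι ι ℝ) : Prop :=
  ∀ z ∈ spectrum ℂ (M.map (algebraMap ℝ ℂ)), z.re < 0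

/-! ### Linear equations driven by a continuous path -/

/-- The solution `z` of `z(t) = z₀ + ∫₀ᵗ M z(s) ds + η(t)`, that is, of `dz = M z dt + dη` when
`η(0) = 0`, written with the variation of constants formula. The next two facts say that it is a
continuous solution, and the only one. -/
def linearResponse {ι : Type*} [Fintype ι] [DecidableEq ι] (M : Matrix ι ι ℝ) (z₀ : ι → ℝ)
    (η : ℝ → ι → ℝ) (t : ℝ) : ι → ℝ :=
  NormedSpace.exp (t • M) *ᵥ z₀ + η t
    + ∫ s in (0 : ℝ)..t, NormedSpace.exp ((t - s) • M) *ᵥ (M *ᵥ η s)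

section
attribute [local instance] Matrix.linftyOpNormedRing Matrix.linftyOpNormedAlgebra
  Matrix.linftyOpNormedSpace Matrix.linftyOpNormedAddCommGroup

variable {ι : Type*} [Fintype ι] [DecidableEq ι]

theorem hasDerivAt_exp_mulVec (M : Matrix ι ι ℝ) (f : ℝ → ι → ℝ) (f' : ι → ℝ) (t : ℝ) (hf : HasDerivAt f f' t) :
    HasDerivAt (fun t : ℝ => NormedSpace.exp (t • M) *ᵥ f t)
      (M *ᵥ (NormedSpace.exp (t • M) *ᵥ f t) + NormedSpace.exp (t • M) *ᵥ f') t := by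
  have h1 : HasDerivAt (fun t : ℝ => NormedSpace.exp (t • M)) (M * NormedSpace.exp (t • M)) t :=
    hasDerivAt_exp_smul_const' M t
  rw [hasDerivAt_pi] at hf ⊢
  intro i
  have h2 : ∀ i j, HasDerivAt (fun t : ℝ => NormedSpace.exp (t • M) i j) ((M * NormedSpace.exp (t • M)) i j) t := by
    intro i j
    let L : Matrix ι ι ℝ →L[ℝ] ℝ := LinearMap.toContinuousLinearMap (Matrix.entryLinearMap ℝ ℝ i j)
    exact L.hasFDerivAt.comp_hasDerivAt t h1
  have := HasDerivAt.fun_sum (u := Finset.univ) (fun j _ => (h2 i j).mul (hf j))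
  simp only [Matrix.mulVec_mulVec, Pi.add_apply]
  simpa [Matrix.mulVec, dotProduct, Finset.sum_add_distrib] using this

theorem continuous_exp_smul (M : Matrix ι ι ℝ) : Continuous fun s : ℝ => NormedSpace.exp (s • M) :=
  continuous_iff_continuousAt.2 fun t => (hasDerivAt_exp_smul_const' (𝕂 := ℝ) M t).continuousAt

theorem exp_smul_mulVec_neg (M : Matrix ι ι ℝ) (t : ℝ) (x : ι → ℝ) :
    NormedSpace.exp (t • M) *ᵥ (NormedSpace.exp ((-t) • M) *ᵥ x) = x := by
  rw [Matrix.mulVec_mulVec, ← Matrix.exp_add_of_commute, ← add_smul]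
  · simp
  · exact ((Commute.refl M).smul_left t).smul_right (-t)

theorem linearResponse_eq (M : Matrix ι ι ℝ) (z₀ : ι → ℝ) (η : ℝ → ι → ℝ) (hη : Continuous η) (t : ℝ) :
    linearResponse M z₀ η t = η t + NormedSpace.exp (t • M) *ᵥ
      (z₀ + ∫ s in (0 : ℝ)..t, NormedSpace.exp ((-s) • M) *ᵥ (M *ᵥ η s)) := by
  have hc : Continuous fun s : ℝ => NormedSpace.exp ((-s) • M) *ᵥ (M *ᵥ η s) :=
    ((continuous_exp_smul M).comp continuous_neg).matrix_mulVec (continuous_const.matrix_mulVec hη)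
  have h : ∫ s in (0 : ℝ)..t, NormedSpace.exp ((t - s) • M) *ᵥ (M *ᵥ η s)
      = NormedSpace.exp (t • M) *ᵥ ∫ s in (0 : ℝ)..t, NormedSpace.exp ((-s) • M) *ᵥ (M *ᵥ η s) := by
    let L : (ι → ℝ) →L[ℝ] (ι → ℝ) :=
      LinearMap.toContinuousLinearMap (Matrix.mulVecLin (NormedSpace.exp (t • M)))
    have := L.intervalIntegral_comp_comm (hc.intervalIntegrable 0 t) (μ := volume)
    refine Eq.trans ?_ this
    congr 1
    funext s
    change _ = NormedSpace.exp (t • M) *ᵥ (NormedSpace.exp ((-s) • M) *ᵥ (M *ᵥ η s))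
    rw [Matrix.mulVec_mulVec _ (NormedSpace.exp (t • M)), ← Matrix.exp_add_of_commute, ← add_smul,
      sub_eq_add_neg]
    exact ((Commute.refl M).smul_left t).smul_right (-s)
  rw [linearResponse, h, Matrix.mulVec_add]
  abel

/-- `linearResponse` is continuous and solves `z(t) = z₀ + ∫₀ᵗ M z(s) ds + η(t)`. -/
theorem linearResponse_spec (M : Matrix ι ι ℝ) (z₀ : ι → ℝ) {η : ℝ → ι → ℝ} (hη : Continuous η) :
    Continuous (linearResponse M z₀ η) ∧
      ∀ t, linearResponse M z₀ η t
        = z₀ + (∫ s in (0 : ℝ)..t, M *ᵥ linearResponse M z₀ η s) + η t := by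
  have hc : Continuous fun s : ℝ => NormedSpace.exp ((-s) • M) *ᵥ (M *ᵥ η s) :=
    ((continuous_exp_smul M).comp continuous_neg).matrix_mulVec (continuous_const.matrix_mulVec hη)
  have hy : ∀ t, HasDerivAt (fun t => NormedSpace.exp (t • M) *ᵥ
      (z₀ + ∫ s in (0 : ℝ)..t, NormedSpace.exp ((-s) • M) *ᵥ (M *ᵥ η s)))
      (M *ᵥ linearResponse M z₀ η t) t := by
    intro t
    have h := hasDerivAt_exp_mulVec M _ _ t
      ((hc.integral_hasStrictDerivAt 0 t).hasDerivAt.const_add z₀)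
    rw [exp_smul_mulVec_neg, ← Matrix.mulVec_add, add_comm _ (η t), ← linearResponse_eq M z₀ η hη] at h
    exact h
  have hcont : Continuous (linearResponse M z₀ η) := by
    rw [funext (linearResponse_eq M z₀ η hη)]
    exact hη.add (continuous_iff_continuousAt.2 fun t => (hy t).continuousAt)
  refine ⟨hcont, fun t => ?_⟩
  have h := intervalIntegral.integral_eq_sub_of_hasDerivAt (a := 0) (b := t) (fun s _ => hy s)
    ((continuous_const.matrix_mulVec hcont).intervalIntegrable 0 t)
  rw [h, linearResponse_eq M z₀ η hη]
  simp
  abel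

/-- Uniqueness of the continuous solution on `t ≥ 0`. -/
theorem linearResponse_unique (M : Matrix ι ι ℝ) (z₀ : ι → ℝ) {η z : ℝ → ι → ℝ}
    (hη : Continuous η) (hz : Continuous z)
    (h : ∀ t, 0 ≤ t → z t = z₀ + (∫ s in (0 : ℝ)..t, M *ᵥ z s) + η t) (t : ℝ) (ht : 0 ≤ t) :
    z t = linearResponse M z₀ η t := by
  have hc : Continuous fun s : ℝ => NormedSpace.exp ((-s) • M) *ᵥ (M *ᵥ η s) :=
    ((continuous_exp_smul M).comp continuous_neg).matrix_mulVec (continuous_const.matrix_mulVec hη)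
  have hg : ∀ s ∈ Set.uIcc 0 t, HasDerivAt (fun r => NormedSpace.exp ((-r) • M) *ᵥ
      (z₀ + ∫ s in (0 : ℝ)..r, M *ᵥ z s)) (NormedSpace.exp ((-s) • M) *ᵥ (M *ᵥ η s)) s := by
    intro s hs
    rw [Set.uIcc_of_le ht] at hs
    have h1 := hasDerivAt_exp_mulVec (-M) _ _ s
      (((continuous_const.matrix_mulVec hz : Continuous fun r => M *ᵥ z r).integral_hasStrictDerivAt
        0 s).hasDerivAt.const_add z₀)
    have hcomm : -M * NormedSpace.exp (s • -M) = NormedSpace.exp (s • -M) * -M :=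
      (((Commute.refl (-M)).smul_right s).exp_right).eq
    rw [Matrix.mulVec_mulVec, hcomm, ← Matrix.mulVec_mulVec, ← Matrix.mulVec_add, h s hs.1,
      Matrix.neg_mulVec, Matrix.mulVec_add M _ (η s), neg_add_cancel_left] at h1
    simpa using h1
  have h2 := intervalIntegral.integral_eq_sub_of_hasDerivAt hg (hc.intervalIntegrable 0 t)
  rw [linearResponse_eq M z₀ η hη, h2, h t ht]
  simp only [neg_zero, zero_smul, NormedSpace.exp_zero, Matrix.one_mulVec,
    intervalIntegral.integral_same, add_zero, add_sub_cancel, exp_smul_mulVec_neg]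
  abel

end
/-! ### White noise -/

/-- `β` is a Brownian motion with covariance (intensity) matrix `Σ`, that is, the time integral of
a white Gaussian noise of intensity `Σ`: it starts at `0`, has continuous paths, and has independent
increments with `β t - β s ∼ N(0, (t - s) Σ)`. -/
structure IsBrownianWithIntensity {ι : Type*} [Fintype ι] [DecidableEq ι]
    {Ω : Type*} [MeasurableSpace Ω] (β : ℝ≥0 → Ω → EuclideanSpace ℝ ι)
    (intensity : Matrix ι ι ℝ) (μ : Measure Ω) : Prop where
  measurable : ∀ t, Measurable (β t)
  zero : ∀ ω, β 0 ω = 0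
  continuous : ∀ ω, Continuous fun t => β t ω
  indep : HasIndepIncrements β μ
  law : ∀ s t, s ≤ t →
    HasLaw (β t - β s) (multivariateGaussian 0 (((t : ℝ) - (s : ℝ)) • intensity)) μ

/-! ### The LQG problem -/

/-- Data of an LQG problem: the plant `dx = (A x + B u) dt + dw`, `dy = C x dt + dv`, the cost
weights `Q`, `R`, and the intensities `W`, `V` of the process and measurement noises. -/
structure Problem (n m p : ℕ) where
  A : Matrix (Fin n) (Fin n) ℝ
  B : Matrix (Fin n) (Fin m) ℝ
  C : Matrix (Fin p) (Fin n) ℝ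
  Q : Matrix (Fin n) (Fin n) ℝ
  R : Matrix (Fin m) (Fin m) ℝ
  W : Matrix (Fin n) (Fin n) ℝ
  V : Matrix (Fin p) (Fin p) ℝ

/-- A strictly proper full-order dynamic controller `(A_K, B_K, C_K)`:
`dξ = A_K ξ dt + B_K dy`, `u = C_K ξ`. -/
abbrev Controller (n m p : ℕ) : Type :=
  Matrix (Fin n) (Fin n) ℝ × Matrix (Fin n) (Fin p) ℝ × Matrix (Fin m) (Fin n) ℝ

variable {n m p : ℕ}

abbrev Controller.AK (K : Controller n m p) : Matrix (Fin n) (Fin n) ℝ := K.1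

abbrev Controller.BK (K : Controller n m p) : Matrix (Fin n) (Fin p) ℝ := K.2.1

abbrev Controller.CK (K : Controller n m p) : Matrix (Fin m) (Fin n) ℝ := K.2.2

/-- A controller is minimal if it is controllable and observable. -/
def Controller.IsMinimal (K : Controller n m p) : Prop :=
  Controllable (Controller.AK K) (Controller.BK K) ∧
    Observable (Controller.CK K) (Controller.AK K)

/-- The standing assumptions on weights and noise intensities, and minimality:
`(A, B)` and `(A, W^{1/2})` are controllable, `(C, A)` and `(Q^{1/2}, A)` are observable. -/
structure Problem.IsMinimal (S : Problem n m p) : Prop where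
  Q_psd : S.Q.PosSemidef
  R_pd : S.R.PosDef
  W_psd : S.W.PosSemidef
  V_pd : S.V.PosDef
  controllable_AB : Controllable S.A S.B
  controllable_AW : Controllable S.A (CFC.sqrt S.W)
  observable_CA : Observable S.C S.A
  observable_QA : Observable (CFC.sqrt S.Q) S.A

/-- The closed-loop matrix `[A, B C_K; B_K C, A_K]`. -/
def Problem.closedLoop (S : Problem n m p) (K : Controller n m p) :
    Matrix (Fin n ⊕ Fin n) (Fin n ⊕ Fin n) ℝ :=
  Matrix.fromBlocks S.A (S.B * Controller.CK K) (Controller.BK K * S.C) (Controller.AK K)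

/-- The set `C_n` of internally stabilizing full-order controllers. -/
def Problem.stabilizing (S : Problem n m p) : Set (Controller n m p) :=
  {K | IsStable (S.closedLoop K)}

/-- The noise entering the closed loop, integrated in time: the stacked path `(w, B_K v)`. -/
def closedLoopNoise {Ω : Type*} (w : ℝ≥0 → Ω → EuclideanSpace ℝ (Fin n))
    (v : ℝ≥0 → Ω → EuclideanSpace ℝ (Fin p)) (K : Controller n m p) (ω : Ω) (t : ℝ) :
    Fin n ⊕ Fin n → ℝ :=
  Sum.elim (w t.toNNReal ω).ofLp (Controller.BK K *ᵥ (v t.toNNReal ω).ofLp)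

/-- The closed-loop state `(x(t), ξ(t))`: the solution of
`x(t) = x₀ + ∫₀ᵗ (A x + B C_K ξ) ds + w(t)`, `ξ(t) = ξ₀ + ∫₀ᵗ (B_K C x + A_K ξ) ds + B_K v(t)`. -/
def Problem.state (S : Problem n m p) {Ω : Type*} (w : ℝ≥0 → Ω → EuclideanSpace ℝ (Fin n))
    (v : ℝ≥0 → Ω → EuclideanSpace ℝ (Fin p)) (x₀ ξ₀ : Ω → Fin n → ℝ) (K : Controller n m p)
    (t : ℝ) (ω : Ω) : Fin n ⊕ Fin n → ℝ :=
  linearResponse (S.closedLoop K) (Sum.elim (x₀ ω) (ξ₀ ω)) (closedLoopNoise w v K ω) t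

/-- The instantaneous cost `xᵀ Q x + uᵀ R u` with `u = C_K ξ`. -/
def Problem.stageCost (S : Problem n m p) (K : Controller n m p) (z : Fin n ⊕ Fin n → ℝ) : ℝ :=
  let x : Fin n → ℝ := fun i => z (Sum.inl i)
  let u : Fin m → ℝ := Controller.CK K *ᵥ fun i => z (Sum.inr i)
  x ⬝ᵥ (S.Q *ᵥ x) + u ⬝ᵥ (S.R *ᵥ u)

/-- The accumulated cost `∫₀ᵀ (xᵀ Q x + uᵀ R u) dt` along the closed loop. -/
def Problem.pathCost (S : Problem n m p) {Ω : Type*} (w : ℝ≥0 → Ω → EuclideanSpace ℝ (Fin n))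
    (v : ℝ≥0 → Ω → EuclideanSpace ℝ (Fin p)) (x₀ ξ₀ : Ω → Fin n → ℝ) (K : Controller n m p)
    (T : ℝ) (ω : Ω) : ℝ :=
  ∫ t in (0 : ℝ)..T, S.stageCost K (S.state w v x₀ ξ₀ K t ω)

/-- The expected average cost `(1/T) E ∫₀ᵀ (xᵀ Q x + uᵀ R u) dt` up to time `T`. -/
def Problem.averageCost (S : Problem n m p) {Ω : Type*} [MeasurableSpace Ω] (μ : Measure Ω)
    (w : ℝ≥0 → Ω → EuclideanSpace ℝ (Fin n)) (v : ℝ≥0 → Ω → EuclideanSpace ℝ (Fin p))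
    (x₀ ξ₀ : Ω → Fin n → ℝ) (K : Controller n m p) (T : ℝ) : ℝ :=
  1 / T * ∫ ω, S.pathCost w v x₀ ξ₀ K T ω ∂μ

/-- The LQG cost `J_n(K) = lim_{T → ∞} (1/T) E ∫₀ᵀ (xᵀ Q x + uᵀ R u) dt`. -/
def Problem.cost (S : Problem n m p) {Ω : Type*} [MeasurableSpace Ω] (μ : Measure Ω)
    (w : ℝ≥0 → Ω → EuclideanSpace ℝ (Fin n)) (v : ℝ≥0 → Ω → EuclideanSpace ℝ (Fin p))
    (x₀ ξ₀ : Ω → Fin n → ℝ) (K : Controller n m p) : ℝ :=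
  limUnder atTop (S.averageCost μ w v x₀ ξ₀ K)

/-! ### The Riccati equations -/

/-- `P` is the unique positive definite solution of `A P + P Aᵀ - P Cᵀ V⁻¹ C P + W = 0`. -/
def Problem.IsUniqueFilterSolution (S : Problem n m p) (P : Matrix (Fin n) (Fin n) ℝ) : Prop :=
  let Sol (X : Matrix (Fin n) (Fin n) ℝ) : Prop := X.PosDef ∧
    S.A * X + X * S.Aᵀ - X * S.Cᵀ * S.V⁻¹ * S.C * X + S.W = 0
  Sol P ∧ ∀ P', Sol P' → P' = P

/-- `Y` is the unique positive definite solution of `Aᵀ Y + Y A - Y B R⁻¹ Bᵀ Y + Q = 0`. -/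
def Problem.IsUniqueControlSolution (S : Problem n m p) (Y : Matrix (Fin n) (Fin n) ℝ) : Prop :=
  let Sol (X : Matrix (Fin n) (Fin n) ℝ) : Prop := X.PosDef ∧
    S.Aᵀ * X + X * S.A - X * S.B * S.R⁻¹ * S.Bᵀ * X + S.Q = 0
  Sol Y ∧ ∀ Y', Sol Y' → Y' = Y

end

end LQG

namespace LQG

/-! ### Exponential decay of the flow of a stable matrix -/

section Decay

attribute [local instance] Matrix.linftyOpNormedRing Matrix.linftyOpNormedAlgebra
  Matrix.linftyOpNormedSpace Matrix.linftyOpNormedAddCommGroup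

variable {ι : Type*} [Fintype ι] [DecidableEq ι]

/-! Write `M` for the closed-loop matrix, `W̃ = diag(W, B_K V B_Kᵀ)` for the intensity of its noise
and `Q̃ = diag(Q, C_Kᵀ R C_K)` for the cost weight.

The limit. No stochastic integral is needed: the state is a pathwise linear functional of the
Brownian paths, so its second moments follow from the covariance `min(s, r) W̃` by Fubini and
integration by parts. The response to noise has covariance `X - e^{tM} X e^{tMᵀ}`, where `M X + X Mᵀ
+ W̃ = 0`. Stability removes the exponential term and the influence of the initial state, and
averaging over time gives `J(K) = tr(Q̃ X)` (`Problem.cost_spec`).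

Stationarity. Let `Y` solve the adjoint equation `Mᵀ Y + Y M + Q̃ = 0`; it is the stationary
covariance of the dual problem. An exact difference formula for `tr(Q̃ X)` (`trace_lyapunov_sub`)
turns the vanishing of the derivative into three equations between the blocks of `X` and `Y`
(`gradient_blocks`). A minimal controller has `X` and `Y` positive definite, so one may set `F =
-X₁₂ X₂₂⁻¹` and `T = Y₂₂⁻¹ Y₁₂ᵀ`. The equation for the direction `A_K` says `T F = 1`; the other two
give `B_K` and `C_K` in terms of the Schur complements `P` and `Y₁₁ - Y₁₂ Y₂₂⁻¹ Y₁₂ᵀ`. Combining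
blocks of the Lyapunov equation then yields `A_K` and the filter Riccati equation for `P`
(`riccati_of_lyapunov`); the same lemma for the dual problem yields the control Riccati equation.

Global optimality. Write now `Y` for the control Riccati solution and `G = R⁻¹ Bᵀ Y`. Completing the
square gives `J(K') = tr(Y W) + tr(R [G, C_K'] X' [G, C_K']ᵀ)` for every stabilizing `K'` with
covariance `X'`. Moreover `X' ⪰ diag(P, 0)`: no controller beats the filter error. Hence `J(K') ≥
tr(Y W) + tr(R G P Gᵀ)`, a bound free of `K'`. At `K` one has `[G, C_K] = G [1, F]` and `[1, F] X
[1, F]ᵀ = P`, so the bound is attained. -/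

theorem tendsto_pow_mul_cexp (k : ℕ) {z : ℂ} (hz : z.re < 0) :
    Tendsto (fun t : ℝ => ((t : ℂ) ^ k) * Complex.exp (t * z)) atTop (𝓝 0) := by
  rw [tendsto_zero_iff_norm_tendsto_zero]
  have h := (Real.tendsto_pow_mul_exp_neg_atTop_nhds_zero k).comp
    (tendsto_id.const_mul_atTop (neg_pos.2 hz))
  have h2 := h.const_mul ((-z.re) ^ k)⁻¹
  rw [mul_zero] at h2
  refine h2.congr' ?_
  filter_upwards [eventually_ge_atTop 0] with t ht
  have : (-z.re) ^ k ≠ 0 := pow_ne_zero _ (by linarith)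
  simp only [Function.comp, id, norm_mul, norm_pow, Complex.norm_real, Complex.norm_exp,
    Real.norm_eq_abs, abs_of_nonneg ht, mul_pow, Complex.re_ofReal_mul]
  rw [show - (-z.re * t) = t * z.re by ring]
  field_simp

/-- Split `N = z + N₀`. The scalar part commutes with `N₀` and contributes `e^{tz}`, while the
exponential series of `N₀` applied to a generalized eigenvector stops after `k` terms. -/
theorem exp_smul_mulVec_of_nilpotent (N : Matrix ι ι ℂ) (v : ι → ℂ) (z : ℂ) (k : ℕ)
    (hk : (N - z • (1 : Matrix ι ι ℂ)) ^ k *ᵥ v = 0) (t : ℂ) :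
    NormedSpace.exp (t • N) *ᵥ v = ∑ j ∈ Finset.range k,
      (((j.factorial : ℂ)⁻¹) * (t ^ j * Complex.exp (t * z))) •
        ((N - z • (1 : Matrix ι ι ℂ)) ^ j *ᵥ v) := by
  set N₀ := N - z • (1 : Matrix ι ι ℂ) with hN₀
  have h1 : NormedSpace.exp (t • N) = Complex.exp (t * z) • NormedSpace.exp (t • N₀) := by
    have : t • N = (algebraMap ℂ (Matrix ι ι ℂ)) (t * z) + t • N₀ := by
      rw [hN₀, smul_sub, Algebra.algebraMap_eq_smul_one, smul_smul]; abel
    have h0 : NormedSpace.exp ((algebraMap ℂ (Matrix ι ι ℂ)) (t * z))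
        = (algebraMap ℂ (Matrix ι ι ℂ)) (NormedSpace.exp (t * z)) :=
      (NormedSpace.algebraMap_exp_comm (t * z)).symm
    rw [this, Matrix.exp_add_of_commute _ _ (Algebra.commutes (t * z) (t • N₀)),
      h0, Complex.exp_eq_exp_ℂ]
    exact (Algebra.smul_def _ _).symm
  have h2 := NormedSpace.exp_series_hasSum_exp' (𝕂 := ℂ) (t • N₀)
  let L : Matrix ι ι ℂ →L[ℂ] (ι → ℂ) :=
    LinearMap.toContinuousLinearMap ((Matrix.mulVecBilin ℂ ℂ).flip v)
  have hL : ∀ A, L A = A *ᵥ v := fun A => rfl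
  have h3 := L.hasSum h2
  have h4 : ∀ j, L (((j.factorial : ℂ)⁻¹) • (t • N₀) ^ j)
      = ((j.factorial : ℂ)⁻¹ * t ^ j) • (N₀ ^ j *ᵥ v) := by
    intro j
    rw [hL, smul_pow, smul_smul, Matrix.smul_mulVec]
  have h5 : ∀ j ∉ Finset.range k, L (((j.factorial : ℂ)⁻¹) • (t • N₀) ^ j) = 0 := by
    intro j hj
    rw [h4]
    obtain ⟨l, rfl⟩ := Nat.exists_eq_add_of_le (not_lt.1 (by simpa using hj))
    rw [add_comm k l, pow_add N₀, ← Matrix.mulVec_mulVec, hk]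
    simp
  have h6 : NormedSpace.exp (t • N₀) *ᵥ v = _ := h3.unique (hasSum_sum_of_ne_finset_zero h5)
  rw [h1, Matrix.smul_mulVec, h6, Finset.smul_sum]
  refine Finset.sum_congr rfl fun j _ => ?_
  rw [h4, smul_smul]
  congr 1
  ring

/-- The vectors with decaying orbit form a subspace. It contains each generalized eigenspace, where
the orbit is a polynomial times `e^{tz}`, and over `ℂ` these span everything. -/
theorem tendsto_exp_mulVec_complex (N : Matrix ι ι ℂ) (hN : ∀ z ∈ spectrum ℂ N, z.re < 0)
    (v : ι → ℂ) :
    Tendsto (fun t : ℝ => NormedSpace.exp ((t : ℂ) • N) *ᵥ v) atTop (𝓝 0) := by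
  let E : Submodule ℂ (ι → ℂ) :=
    { carrier := {v | Tendsto (fun t : ℝ => NormedSpace.exp ((t : ℂ) • N) *ᵥ v) atTop (𝓝 0)}
      add_mem' := by
        intro a b ha hb
        simpa [Matrix.mulVec_add] using Tendsto.add ha hb
      zero_mem' := by simp
      smul_mem' := by
        intro c a ha
        simpa [Matrix.mulVec_smul] using Tendsto.const_smul ha c }
  suffices h : E = ⊤ by
    have : v ∈ E := h ▸ Submodule.mem_top
    exact this
  rw [eq_top_iff, ← Module.End.iSup_maxGenEigenspace_eq_top (Matrix.toLin' N)]
  refine iSup_le fun z x hx => ?_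
  rw [Module.End.mem_maxGenEigenspace] at hx
  obtain ⟨k, hk⟩ := hx
  have hk' : (N - z • (1 : Matrix ι ι ℂ)) ^ k *ᵥ x = 0 := by
    rw [← hk, ← Matrix.toLin'_apply, Matrix.toLin'_pow]
    simp [map_sub, Module.End.one_eq_id]
  by_cases hx0 : x = 0
  · rw [hx0]; exact E.zero_mem
  have hz : z.re < 0 := by
    apply hN
    rw [← Matrix.spectrum_toLin', ← Module.End.hasEigenvalue_iff_mem_spectrum]
    refine Module.End.HasUnifEigenvalue.lt (k := (k : ℕ∞)) (by norm_num) ?_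
    rw [Module.End.HasUnifEigenvalue, Submodule.ne_bot_iff]
    exact ⟨x, by rwa [Module.End.mem_genEigenspace_nat], hx0⟩
  change Tendsto _ _ _
  simp_rw [fun t : ℝ => exp_smul_mulVec_of_nilpotent N x z k hk' (t : ℂ)]
  rw [← Finset.sum_const_zero (s := Finset.range k)]
  refine tendsto_finsetSum _ fun j _ => ?_
  have := ((tendsto_pow_mul_cexp j hz).const_mul ((j.factorial : ℂ)⁻¹)).smul_const
    ((N - z • (1 : Matrix ι ι ℂ)) ^ j *ᵥ x)
  simpa using this

theorem exp_map_ofReal (M : Matrix ι ι ℝ) :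
    (NormedSpace.exp M).map (algebraMap ℝ ℂ) = NormedSpace.exp (M.map (algebraMap ℝ ℂ)) := by
  have hc : Continuous (RingHom.mapMatrix (m := ι) (algebraMap ℝ ℂ)) := by
    change Continuous fun A : Matrix ι ι ℝ => A.map (algebraMap ℝ ℂ)
    exact continuous_id.matrix_map Complex.continuous_ofReal
  exact NormedSpace.map_exp (RingHom.mapMatrix (m := ι) (algebraMap ℝ ℂ)) hc M

theorem IsStable.tendsto_exp_mulVec {M : Matrix ι ι ℝ} (hM : IsStable M) (v : ι → ℝ) :
    Tendsto (fun t : ℝ => NormedSpace.exp (t • M) *ᵥ v) atTop (𝓝 0) := by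
  have h := tendsto_exp_mulVec_complex _ hM (fun i => (v i : ℂ))
  rw [tendsto_pi_nhds] at h ⊢
  intro i
  have h2 := (Complex.continuous_re.tendsto _).comp (h i)
  refine h2.congr fun t => ?_
  have h3 : (t : ℂ) • M.map (algebraMap ℝ ℂ) = (t • M).map (algebraMap ℝ ℂ) := by
    ext i j; simp
  have h4 := RingHom.map_mulVec (algebraMap ℝ ℂ) (NormedSpace.exp (t • M)) v i
  simp only [Function.comp, h3, ← exp_map_ofReal]
  exact (congrArg Complex.re h4).symm

theorem IsStable.transpose {M : Matrix ι ι ℝ} (hM : IsStable M) : IsStable Mᵀ := by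
  intro z hz
  apply hM z
  rw [spectrum.mem_iff, Matrix.isUnit_iff_isUnit_det] at hz ⊢
  rwa [← Matrix.det_transpose, Matrix.transpose_sub, ← Matrix.transpose_map,
    Algebra.algebraMap_eq_smul_one, Matrix.transpose_smul, Matrix.transpose_one,
    ← Algebra.algebraMap_eq_smul_one]

theorem IsStable.tendsto_exp {M : Matrix ι ι ℝ} (hM : IsStable M) :
    Tendsto (fun t : ℝ => NormedSpace.exp (t • M)) atTop (𝓝 0) := by
  refine tendsto_pi_nhds.2 fun i => tendsto_pi_nhds.2 fun j => ?_
  have h := tendsto_pi_nhds.1 (hM.tendsto_exp_mulVec (Pi.single j 1)) i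
  simpa using h

end Decay

/-! ### Uniqueness for Sylvester equations with stable coefficients -/

section Lyapunov

attribute [local instance] Matrix.linftyOpNormedRing Matrix.linftyOpNormedAlgebra
  Matrix.linftyOpNormedSpace Matrix.linftyOpNormedAddCommGroup

variable {ι : Type*} [Fintype ι] [DecidableEq ι]

theorem hasDerivAt_exp_mul_mul_exp (M Z N : Matrix ι ι ℝ) (t : ℝ) :
    HasDerivAt (fun t : ℝ => NormedSpace.exp (t • M) * Z * NormedSpace.exp (t • N))
      (NormedSpace.exp (t • M) * (M * Z + Z * N) * NormedSpace.exp (t • N)) t := by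
  have h1 : HasDerivAt (fun t : ℝ => NormedSpace.exp (t • M)) (NormedSpace.exp (t • M) * M) t :=
    hasDerivAt_exp_smul_const M t
  have h2 : HasDerivAt (fun t : ℝ => NormedSpace.exp (t • N)) (N * NormedSpace.exp (t • N)) t :=
    hasDerivAt_exp_smul_const' N t
  refine ((h1.mul_const Z).mul h2).congr_deriv ?_
  simp only [mul_add, add_mul, mul_assoc]

theorem IsStable.tendsto_exp_mul_mul_exp {M N : Matrix ι ι ℝ} (hM : IsStable M) (hN : IsStable N)
    (Z : Matrix ι ι ℝ) :
    Tendsto (fun t : ℝ => NormedSpace.exp (t • M) * Z * NormedSpace.exp (t • N)) atTop (𝓝 0) := by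
  simpa using (hM.tendsto_exp.mul_const Z).mul hN.tendsto_exp

/-- The equation makes `e^{tM} Z e^{tN}` constant in `t`; it equals `Z` at `t = 0` and tends to `0`.
Two different matrices are allowed because the uniqueness of the Riccati solution needs that case.
-/
theorem IsStable.sylvester_unique {M N : Matrix ι ι ℝ} (hM : IsStable M) (hN : IsStable N)
    {Z : Matrix ι ι ℝ} (h : M * Z + Z * N = 0) : Z = 0 := by
  have h1 : ∀ t, HasDerivAt
      (fun t : ℝ => NormedSpace.exp (t • M) * Z * NormedSpace.exp (t • N)) 0 t := by
    intro t
    simpa [h] using hasDerivAt_exp_mul_mul_exp M Z N t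
  have h2 : ∀ t : ℝ, NormedSpace.exp (t • M) * Z * NormedSpace.exp (t • N) = Z := by
    intro t
    have := is_const_of_deriv_eq_zero (fun s => (h1 s).differentiableAt)
      (fun s => (h1 s).deriv) t 0
    simpa using this
  have h3 := hM.tendsto_exp_mul_mul_exp hN Z
  simp_rw [h2] at h3
  exact tendsto_nhds_unique tendsto_const_nhds h3

end Lyapunov

/-! ### The Lyapunov equation: solution, positivity, stability criterion -/

section LyapunovSolution

variable {ι : Type*} [Fintype ι] [DecidableEq ι]

open scoped Kronecker in
/-- The matrix of the Lyapunov operator `X ↦ M X + X Mᵀ` acting on vectorized matrices. -/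
noncomputable def lyapunovOp (M : Matrix ι ι ℝ) : Matrix (ι × ι) (ι × ι) ℝ :=
  (1 : Matrix ι ι ℝ) ⊗ₖ M + M ⊗ₖ (1 : Matrix ι ι ℝ)

theorem lyapunovOp_mulVec_vec (M X : Matrix ι ι ℝ) :
    lyapunovOp M *ᵥ X.vec = (M * X + X * Mᵀ).vec := by
  rw [lyapunovOp, Matrix.add_mulVec, Matrix.kronecker_mulVec_vec, Matrix.kronecker_mulVec_vec]
  simp [Matrix.vec_add]

/-- The solution of `M X + X Mᵀ + W = 0`, provided the Lyapunov operator of `M` is invertible. -/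
noncomputable def lyapunovSol (M W : Matrix ι ι ℝ) : Matrix ι ι ℝ :=
  -- `Matrix.vec` stacks columns, so the entry `(i, j)` sits at the index `(j, i)`.
  Matrix.of fun i j => ((lyapunovOp M)⁻¹ *ᵥ (-W).vec) (j, i)

theorem IsStable.isUnit_det_lyapunovOp {M : Matrix ι ι ℝ} (hM : IsStable M) :
    IsUnit (lyapunovOp M).det := by
  rw [← Matrix.isUnit_iff_isUnit_det, ← Matrix.mulVec_injective_iff_isUnit]
  change Function.Injective (Matrix.mulVecLin (lyapunovOp M))
  rw [injective_iff_map_eq_zero]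
  intro x hx
  obtain ⟨X, rfl⟩ : ∃ X : Matrix ι ι ℝ, x = X.vec := ⟨Matrix.of fun i j => x (j, i), rfl⟩
  rw [Matrix.mulVecLin_apply, lyapunovOp_mulVec_vec, Matrix.vec_eq_zero_iff] at hx
  rw [hM.sylvester_unique hM.transpose hx, Matrix.vec_zero]

theorem IsStable.lyapunovSol_spec {M : Matrix ι ι ℝ} (hM : IsStable M) (W : Matrix ι ι ℝ) :
    M * lyapunovSol M W + lyapunovSol M W * Mᵀ + W = 0 := by
  have h : lyapunovOp M *ᵥ (lyapunovSol M W).vec = (-W).vec := by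
    change lyapunovOp M *ᵥ ((lyapunovOp M)⁻¹ *ᵥ (-W).vec) = _
    rw [Matrix.mulVec_mulVec, Matrix.mul_nonsing_inv _ hM.isUnit_det_lyapunovOp, Matrix.one_mulVec]
  rw [lyapunovOp_mulVec_vec, Matrix.vec_inj] at h
  rw [h, neg_add_cancel]

theorem IsStable.lyapunov_unique {M W X X' : Matrix ι ι ℝ} (hM : IsStable M)
    (h : M * X + X * Mᵀ + W = 0) (h' : M * X' + X' * Mᵀ + W = 0) : X = X' := by
  rw [← sub_eq_zero]
  refine hM.sylvester_unique hM.transpose ?_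
  rw [mul_sub, sub_mul]
  linear_combination (norm := abel) h - h'

omit [Fintype ι] in
theorem continuous_lyapunovOp : Continuous (lyapunovOp (ι := ι)) := by
  refine continuous_matrix fun i j => ?_
  simp only [lyapunovOp, Matrix.add_apply, Matrix.kroneckerMap_apply]
  exact (continuous_const.mul (continuous_id.matrix_elem _ _)).add
    ((continuous_id.matrix_elem _ _).mul continuous_const)

theorem tendsto_matrix_inv {α : Type*} {l : Filter α} {A' : α → Matrix ι ι ℝ} {A : Matrix ι ι ℝ}
    (hA : IsUnit A.det) (h : Tendsto A' l (𝓝 A)) : Tendsto (fun a => (A' a)⁻¹) l (𝓝 A⁻¹) := by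
  have h1 : Tendsto (fun a => (A' a).det) l (𝓝 A.det) :=
    ((continuous_id.matrix_det).tendsto A).comp h
  have h2 : Tendsto (fun a => (A' a).adjugate) l (𝓝 A.adjugate) :=
    ((continuous_id.matrix_adjugate).tendsto A).comp h
  simp only [Matrix.inv_def, Ring.inverse_eq_inv']
  exact (h1.inv₀ hA.ne_zero).smul h2

/-- The solution is an explicit formula in a matrix inverse, which is continuous wherever the
determinant is invertible. This continuity is the only regularity of the covariance that the
gradient computation uses. -/
theorem IsStable.tendsto_lyapunovSol {M : Matrix ι ι ℝ} (hM : IsStable M) {α : Type*}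
    {l : Filter α} {M' W' : α → Matrix ι ι ℝ} {W : Matrix ι ι ℝ} (hM' : Tendsto M' l (𝓝 M))
    (hW' : Tendsto W' l (𝓝 W)) :
    Tendsto (fun a => lyapunovSol (M' a) (W' a)) l (𝓝 (lyapunovSol M W)) := by
  have h1 := tendsto_matrix_inv hM.isUnit_det_lyapunovOp
    ((continuous_lyapunovOp.tendsto M).comp hM')
  have h2 : Tendsto (fun a => (-W' a).vec) l (𝓝 (-W).vec) :=
    tendsto_pi_nhds.2 fun k => ((continuous_id.neg.matrix_elem k.2 k.1).tendsto W).comp hW'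
  refine tendsto_pi_nhds.2 fun i => tendsto_pi_nhds.2 fun j => ?_
  simp only [lyapunovSol, Matrix.mulVec, dotProduct, Matrix.of_apply]
  exact tendsto_finsetSum _ fun k _ =>
    (tendsto_pi_nhds.1 (tendsto_pi_nhds.1 h1 (j, i)) k).mul (tendsto_pi_nhds.1 h2 k)

theorem IsStable.lyapunov_transpose {M W X : Matrix ι ι ℝ} (hM : IsStable M) (hW : Wᵀ = W)
    (h : M * X + X * Mᵀ + W = 0) : Xᵀ = X := by
  refine hM.lyapunov_unique ?_ h
  have := congrArg Matrix.transpose h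
  simp only [Matrix.transpose_add, Matrix.transpose_mul, Matrix.transpose_transpose, hW,
    Matrix.transpose_zero] at this
  rw [add_comm (M * Xᵀ)]
  exact this

theorem exp_smul_transpose (M : Matrix ι ι ℝ) (t : ℝ) :
    NormedSpace.exp (t • Mᵀ) = (NormedSpace.exp (t • M))ᵀ := by
  rw [← Matrix.exp_transpose, Matrix.transpose_smul]

section
attribute [local instance] Matrix.linftyOpNormedRing Matrix.linftyOpNormedAlgebra
  Matrix.linftyOpNormedSpace Matrix.linftyOpNormedAddCommGroup

/-- The function `vᵀ e^{tM} X e^{tMᵀ} v` has derivative `-vᵀ e^{tM} W e^{tMᵀ} v ≤ 0` and tends to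
`0`, so its value `vᵀ X v` at `t = 0` is nonnegative. -/
theorem IsStable.posSemidef_of_lyapunov {M W X : Matrix ι ι ℝ} (hM : IsStable M)
    (hW : W.PosSemidef) (h : M * X + X * Mᵀ + W = 0) : X.PosSemidef := by
  have hWt : Wᵀ = W := by simpa using hW.isHermitian.eq
  have hXt := hM.lyapunov_transpose hWt h
  refine Matrix.PosSemidef.of_dotProduct_mulVec_nonneg (by simpa [Matrix.IsHermitian] using hXt)
    fun v => ?_
  simp only [star_trivial]
  let L : Matrix ι ι ℝ →L[ℝ] ℝ := LinearMap.toContinuousLinearMap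
    ((dotProductBilin ℝ ℝ v).comp ((Matrix.mulVecBilin ℝ ℝ).flip v))
  have hL : ∀ A, L A = v ⬝ᵥ (A *ᵥ v) := fun A => rfl
  have hd : ∀ t, HasDerivAt
      (fun t : ℝ => L (NormedSpace.exp (t • M) * X * NormedSpace.exp (t • Mᵀ)))
      (L (NormedSpace.exp (t • M) * (M * X + X * Mᵀ) * NormedSpace.exp (t • Mᵀ))) t := fun t =>
    L.hasFDerivAt.comp_hasDerivAt t (hasDerivAt_exp_mul_mul_exp M X Mᵀ t)
  have hanti := antitone_of_deriv_nonpos (fun t => (hd t).differentiableAt) fun t => by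
    rw [(hd t).deriv, eq_neg_of_add_eq_zero_left h, hL, mul_neg, neg_mul, Matrix.neg_mulVec,
      dotProduct_neg, neg_nonpos, exp_smul_transpose]
    have := (hW.mul_mul_conjTranspose_same (NormedSpace.exp (t • M))).dotProduct_mulVec_nonneg v
    simpa using this
  have ht := (L.continuous.tendsto 0).comp (hM.tendsto_exp_mul_mul_exp hM.transpose X)
  rw [map_zero] at ht
  have := hanti.le_of_tendsto ht 0
  simpa [hL] using this

end

omit [DecidableEq ι] in
/-- The kernel of the solution of a Lyapunov equation lies in the kernel of the inhomogeneity and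
is invariant. -/
theorem mulVec_eq_zero_of_lyapunov {M W X : Matrix ι ι ℝ} (hX : X.PosSemidef)
    (hW : W.PosSemidef) (h : M * X + X * Mᵀ + W = 0) {v : ι → ℝ} (hv : X *ᵥ v = 0) :
    W *ᵥ v = 0 ∧ X *ᵥ (Mᵀ *ᵥ v) = 0 := by
  have hXt : Xᵀ = X := by simpa using hX.isHermitian.eq
  have h1 : M *ᵥ (X *ᵥ v) + X *ᵥ (Mᵀ *ᵥ v) + W *ᵥ v = 0 := by
    rw [Matrix.mulVec_mulVec, Matrix.mulVec_mulVec, ← Matrix.add_mulVec, ← Matrix.add_mulVec, h,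
      Matrix.zero_mulVec]
  rw [hv, Matrix.mulVec_zero, zero_add] at h1
  have h2 : W *ᵥ v = 0 := by
    -- Pairing the equation with `v` on the left as well kills the term `X Mᵀ v`, since `vᵀ X = 0`.
    rw [← hW.dotProduct_mulVec_zero_iff]
    have h3 := congrArg (fun u => v ⬝ᵥ u) h1
    simp only [dotProduct_add, dotProduct_zero] at h3
    rw [Matrix.dotProduct_mulVec, ← Matrix.mulVec_transpose, hXt, hv, zero_dotProduct,
      zero_add] at h3
    simpa using h3
  exact ⟨h2, by simpa [h2] using h1⟩

/-- A kernel vector of `X` has its whole orbit under `Mᵀ` in the kernel of `X`, hence in that of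
`W`; the observability-type hypothesis rules this out. -/
theorem IsStable.posDef_of_lyapunov {M W X : Matrix ι ι ℝ} (hM : IsStable M)
    (hW : W.PosSemidef) (h : M * X + X * Mᵀ + W = 0)
    (hobs : ∀ v, (∀ k : ℕ, W *ᵥ ((Mᵀ ^ k) *ᵥ v) = 0) → v = 0) : X.PosDef := by
  have hX := hM.posSemidef_of_lyapunov hW h
  refine Matrix.PosDef.of_dotProduct_mulVec_pos hX.isHermitian fun v hv => ?_
  refine lt_of_le_of_ne (hX.dotProduct_mulVec_nonneg v) fun h0 => hv ?_
  have h1 := (hX.dotProduct_mulVec_zero_iff v).1 h0.symm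
  have h2 : ∀ k : ℕ, X *ᵥ ((Mᵀ ^ k) *ᵥ v) = 0 := by
    intro k
    induction k with
    | zero => simpa using h1
    | succ k ih =>
      rw [pow_succ', ← Matrix.mulVec_mulVec]
      exact (mulVec_eq_zero_of_lyapunov hX hW h ih).2
  exact hobs v fun k => (mulVec_eq_zero_of_lyapunov hX hW h (h2 k)).1

/-- A real matrix `N` is stable if `N P + P Nᵀ + H = 0` with `P` positive definite, `H` positive
semidefinite and no invariant real plane of `Nᵀ` inside the kernel of `H`. -/
theorem isStable_of_lyapunov {N P H : Matrix ι ι ℝ} (hP : P.PosDef) (hH : H.PosSemidef)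
    (h : N * P + P * Nᵀ + H = 0)
    (hker : ∀ (σ ω : ℝ) (a b : ι → ℝ), Nᵀ *ᵥ a = σ • a - ω • b → Nᵀ *ᵥ b = ω • a + σ • b →
      H *ᵥ a = 0 → H *ᵥ b = 0 → a = 0 ∧ b = 0) : IsStable N := by
  rw [← Matrix.transpose_transpose N]
  refine IsStable.transpose fun z hz => ?_
  rw [← Matrix.spectrum_toLin', ← Module.End.hasEigenvalue_iff_mem_spectrum] at hz
  obtain ⟨x, hx⟩ := hz.exists_hasEigenvector
  have hx1 : Nᵀ.map (algebraMap ℝ ℂ) *ᵥ x = z • x := by simpa using hx.apply_eq_smul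
  set a : ι → ℝ := fun i => (x i).re with ha
  set b : ι → ℝ := fun i => (x i).im with hb
  have h1 : Nᵀ *ᵥ a = z.re • a - z.im • b := by
    ext i
    have := congrArg Complex.re (congrFun hx1 i)
    simpa [Matrix.mulVec, dotProduct, ha, hb] using this
  have h2 : Nᵀ *ᵥ b = z.im • a + z.re • b := by
    ext i
    have := congrArg Complex.im (congrFun hx1 i)
    simp [Matrix.mulVec, dotProduct, ha, hb] at this ⊢
    linarith
  have hPt : Pᵀ = P := by simpa using hP.1.eq
  -- For an eigenvector `a + i b` of `Nᵀ`, the sum of this identity at `a` and at `b` loses its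
  -- cross terms and reads `2 Re z (aᵀPa + bᵀPb) + aᵀHa + bᵀHb = 0`. If `Re z ≥ 0`, then all terms
  -- vanish and `a`, `b` lie in the kernel of `H`.
  have key : ∀ c : ι → ℝ, 2 * ((P *ᵥ c) ⬝ᵥ (Nᵀ *ᵥ c)) + c ⬝ᵥ (H *ᵥ c) = 0 := by
    intro c
    have h3 : c ⬝ᵥ ((N * P + P * Nᵀ + H) *ᵥ c) = 0 := by rw [h]; simp
    rw [Matrix.add_mulVec, Matrix.add_mulVec, dotProduct_add, dotProduct_add,
      ← Matrix.mulVec_mulVec, ← Matrix.mulVec_mulVec, Matrix.dotProduct_mulVec c N,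
      Matrix.dotProduct_mulVec c P, ← Matrix.mulVec_transpose, ← Matrix.mulVec_transpose, hPt,
      dotProduct_comm (Nᵀ *ᵥ c)] at h3
    linarith
  have hab : (P *ᵥ a) ⬝ᵥ b = (P *ᵥ b) ⬝ᵥ a := by
    rw [dotProduct_comm, Matrix.dotProduct_mulVec, ← Matrix.mulVec_transpose, hPt]
  have hka := key a
  have hkb := key b
  rw [h1, dotProduct_sub, dotProduct_smul, dotProduct_smul] at hka
  rw [h2, dotProduct_add, dotProduct_smul, dotProduct_smul, ← hab] at hkb
  simp only [smul_eq_mul] at hka hkb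
  have hHa := hH.dotProduct_mulVec_nonneg a
  have hHb := hH.dotProduct_mulVec_nonneg b
  have hPa := hP.posSemidef.dotProduct_mulVec_nonneg a
  have hPb := hP.posSemidef.dotProduct_mulVec_nonneg b
  simp only [star_trivial] at hHa hHb hPa hPb
  rw [dotProduct_comm] at hPa hPb
  by_contra! hneg
  have hza := mul_nonneg hneg hPa
  have hzb := mul_nonneg hneg hPb
  have h4 := (hH.dotProduct_mulVec_zero_iff a).1 (by rw [star_trivial]; linarith)
  have h5 := (hH.dotProduct_mulVec_zero_iff b).1 (by rw [star_trivial]; linarith)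
  obtain ⟨ha0, hb0⟩ := hker _ _ a b h1 h2 h4 h5
  refine hx.2 (funext fun i => Complex.ext ?_ ?_)
  · simpa [ha] using congrFun ha0 i
  · simpa [hb] using congrFun hb0 i

omit [DecidableEq ι] in
theorem abs_dotProduct_mulVec_le (E : Matrix ι ι ℝ) (v : ι → ℝ) :
    |v ⬝ᵥ (E *ᵥ v)| ≤ (∑ i, ∑ j, |E i j|) * (v ⬝ᵥ v) := by
  have hv : ∀ i, v i * v i ≤ v ⬝ᵥ v := fun i =>
    Finset.single_le_sum (f := fun i => v i * v i) (fun j _ => mul_self_nonneg _)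
      (Finset.mem_univ i)
  have h : v ⬝ᵥ (E *ᵥ v) = ∑ i, ∑ j, v i * (E i j * v j) := by
    simp only [dotProduct, Matrix.mulVec, Finset.mul_sum]
  rw [h, Finset.sum_mul]
  refine (Finset.abs_sum_le_sum_abs _ _).trans (Finset.sum_le_sum fun i _ => ?_)
  rw [Finset.sum_mul]
  refine (Finset.abs_sum_le_sum_abs _ _).trans (Finset.sum_le_sum fun j _ => ?_)
  rw [abs_mul, abs_mul]
  have h1 : |v i| * |v j| ≤ v ⬝ᵥ v := by
    have h2 := hv i
    have h3 := hv j
    rw [← abs_mul_abs_self] at h2 h3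
    nlinarith [sq_nonneg (|v i| - |v j|)]
  nlinarith [abs_nonneg (E i j)]

/-- The Lyapunov certificate `Z` of `M` with inhomogeneity `1` still works nearby: once the entries
of `M' Z + Z M'ᵀ + 1` sum in absolute value to less than `1`, the matrix `-(M' Z + Z M'ᵀ)` is
positive definite. -/
theorem IsStable.eventually_isStable {M : Matrix ι ι ℝ} (hM : IsStable M) {α : Type*}
    {l : Filter α} {M' : α → Matrix ι ι ℝ} (hM' : Tendsto M' l (𝓝 M)) :
    ∀ᶠ a in l, IsStable (M' a) := by
  have hZ := hM.lyapunovSol_spec 1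
  set Z := lyapunovSol M 1
  have hZpd : Z.PosDef := hM.posDef_of_lyapunov Matrix.PosSemidef.one hZ
    fun v hv => by simpa using hv 0
  let g : Matrix ι ι ℝ → ℝ := fun A => ∑ i, ∑ j, |(A * Z + Z * Aᵀ + 1) i j|
  have hg : Continuous g := by
    have h1 : Continuous fun A : Matrix ι ι ℝ => A * Z + Z * Aᵀ + 1 :=
      ((continuous_id.mul continuous_const).add
        (continuous_const.mul continuous_id.matrix_transpose)).add continuous_const
    exact continuous_finsetSum _ fun i _ => continuous_finsetSum _ fun j _ =>
      (h1.matrix_elem i j).abs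
  have hgM : g M = 0 := by simp only [g, hZ]; simp
  have h1 : ∀ᶠ a in l, g (M' a) < 1 := by
    have := (hg.tendsto M).comp hM'
    rw [hgM] at this
    exact this.eventually (gt_mem_nhds one_pos)
  filter_upwards [h1] with a ha
  have hpd : (-(M' a * Z + Z * (M' a)ᵀ)).PosDef := by
    refine Matrix.PosDef.of_dotProduct_mulVec_pos ?_ fun v hv => ?_
    · have hZt : Zᵀ = Z := by simpa using hZpd.1.eq
      simp [Matrix.IsHermitian, hZt, add_comm]
    · have h2 := abs_dotProduct_mulVec_le (M' a * Z + Z * (M' a)ᵀ + 1) v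
      have h3 : 0 < v ⬝ᵥ v := by
        have := Matrix.dotProduct_star_self_pos_iff.2 hv
        simpa using this
      rw [Matrix.add_mulVec, dotProduct_add, Matrix.one_mulVec] at h2
      rw [star_trivial, Matrix.neg_mulVec, dotProduct_neg]
      have h4 := le_abs_self (v ⬝ᵥ (M' a * Z + Z * (M' a)ᵀ) *ᵥ v + v ⬝ᵥ v)
      have h5 : g (M' a) * (v ⬝ᵥ v) < 1 * (v ⬝ᵥ v) := mul_lt_mul_of_pos_right ha h3
      change _ ≤ g (M' a) * (v ⬝ᵥ v) at h2
      linarith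
  refine isStable_of_lyapunov hZpd hpd.posSemidef (add_neg_cancel _)
    fun σ ω x y _ _ hx hy => ?_
  have hz : ∀ x, -(M' a * Z + Z * (M' a)ᵀ) *ᵥ x = 0 → x = 0 := by
    intro x hx
    by_contra h0
    have := hpd.dotProduct_mulVec_pos h0
    rw [hx, dotProduct_zero] at this
    exact lt_irrefl _ this
  exact ⟨hz x hx, hz y hy⟩

end LyapunovSolution

/-! ### Square integrable processes, Fubini and time averages -/

section SecondOrder

variable {Ω : Type*} [MeasurableSpace Ω] {μ : Measure Ω}

/-- A real process on `[0, ∞)` with jointly measurable paths and locally bounded second moments. -/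
structure IsSquareIntegrablePath (f : ℝ → Ω → ℝ) (μ : Measure Ω) : Prop where
  aesm : AEStronglyMeasurable (fun q : Ω × ℝ => f q.2 q.1) (μ.prod volume)
  memLp : ∀ t, 0 ≤ t → MemLp (f t) 2 μ
  bound : ∃ v : ℝ → ℝ, Continuous v ∧ ∀ t, 0 ≤ t → ∫ ω, f t ω ^ 2 ∂μ ≤ v t

theorem IsSquareIntegrablePath.of_continuous {f : ℝ → Ω → ℝ} (hm : ∀ t, Measurable (f t))
    (hc : ∀ ω, Continuous fun t => f t ω) (hL : ∀ t, 0 ≤ t → MemLp (f t) 2 μ)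
    (hb : ∃ v : ℝ → ℝ, Continuous v ∧ ∀ t, 0 ≤ t → ∫ ω, f t ω ^ 2 ∂μ ≤ v t) :
    IsSquareIntegrablePath f μ where
  aesm := ((measurable_uncurry_of_continuous_of_measurable hc hm).comp
    measurable_swap).aestronglyMeasurable
  memLp := hL
  bound := hb

theorem IsSquareIntegrablePath.const {Z : Ω → ℝ} (hZ : MemLp Z 2 μ) :
    IsSquareIntegrablePath (fun _ => Z) μ where
  aesm := hZ.aestronglyMeasurable.comp_fst
  memLp _ _ := hZ
  bound := ⟨fun _ => ∫ ω, Z ω ^ 2 ∂μ, continuous_const, fun _ _ => le_rfl⟩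

theorem IsSquareIntegrablePath.mul_continuous {f : ℝ → Ω → ℝ} (hf : IsSquareIntegrablePath f μ)
    {a : ℝ → ℝ} (ha : Continuous a) : IsSquareIntegrablePath (fun t ω => a t * f t ω) μ where
  aesm := (ha.measurable.comp measurable_snd).aestronglyMeasurable.mul hf.aesm
  memLp t ht := (hf.memLp t ht).const_mul (a t)
  bound := by
    obtain ⟨v, hv, hvb⟩ := hf.bound
    refine ⟨fun t => a t ^ 2 * v t, by fun_prop, fun t ht => ?_⟩
    simp_rw [mul_pow]
    rw [integral_const_mul]
    exact mul_le_mul_of_nonneg_left (hvb t ht) (sq_nonneg _)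

theorem IsSquareIntegrablePath.add {f g : ℝ → Ω → ℝ} (hf : IsSquareIntegrablePath f μ)
    (hg : IsSquareIntegrablePath g μ) :
    IsSquareIntegrablePath (fun t ω => f t ω + g t ω) μ where
  aesm := hf.aesm.add hg.aesm
  memLp t ht := (hf.memLp t ht).add (hg.memLp t ht)
  bound := by
    obtain ⟨v, hv, hvb⟩ := hf.bound
    obtain ⟨u, hu, hub⟩ := hg.bound
    refine ⟨fun t => 2 * v t + 2 * u t, by fun_prop, fun t ht => ?_⟩
    have h1 := (hf.memLp t ht).integrable_sq
    have h2 := (hg.memLp t ht).integrable_sq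
    calc ∫ ω, (f t ω + g t ω) ^ 2 ∂μ ≤ ∫ ω, 2 * f t ω ^ 2 + 2 * g t ω ^ 2 ∂μ :=
          integral_mono ((hf.memLp t ht).add (hg.memLp t ht)).integrable_sq
            ((h1.const_mul 2).add (h2.const_mul 2)) fun ω => by
              dsimp only
              nlinarith [sq_nonneg (f t ω - g t ω)]
      _ = 2 * ∫ ω, f t ω ^ 2 ∂μ + 2 * ∫ ω, g t ω ^ 2 ∂μ := by
          rw [integral_add (h1.const_mul 2) (h2.const_mul 2), integral_const_mul,
            integral_const_mul]
      _ ≤ _ := by linarith [hvb t ht, hub t ht]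

theorem IsSquareIntegrablePath.sum {κ : Type*} (s : Finset κ) {f : κ → ℝ → Ω → ℝ}
    (hf : ∀ k, IsSquareIntegrablePath (f k) μ) :
    IsSquareIntegrablePath (fun t ω => ∑ k ∈ s, f k t ω) μ := by
  classical
  induction s using Finset.induction_on with
  | empty => simpa using IsSquareIntegrablePath.const (MemLp.zero' (μ := μ))
  | insert k s hk ih =>
    simp_rw [Finset.sum_insert hk]
    exact (hf k).add ih

variable [IsProbabilityMeasure μ]

/-- Tonelli: a continuous bound on the second moments is integrable over `(0, T]`. Joint square
integrability is what justifies every later exchange of expectation and time integral. -/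
theorem IsSquareIntegrablePath.memLp_prod {f : ℝ → Ω → ℝ} (hf : IsSquareIntegrablePath f μ)
    (T : ℝ) :
    MemLp (fun q : Ω × ℝ => f q.2 q.1) 2 (μ.prod (volume.restrict (Set.Ioc 0 T))) := by
  have hae : AEStronglyMeasurable (fun q : Ω × ℝ => f q.2 q.1)
      (μ.prod (volume.restrict (Set.Ioc 0 T))) :=
    hf.aesm.mono_ac (Measure.AbsolutelyContinuous.rfl.prod Measure.absolutelyContinuous_restrict)
  rw [memLp_two_iff_integrable_sq hae]
  refine (integrable_prod_iff' (hae.pow 2)).2 ?_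
  obtain ⟨v, hv, hvb⟩ := hf.bound
  constructor
  · filter_upwards [ae_restrict_mem measurableSet_Ioc] with t ht
    exact (hf.memLp t ht.1.le).integrable_sq
  · have hvi : Integrable v (volume.restrict (Set.Ioc 0 T)) :=
      (hv.integrableOn_Icc (a := 0) (b := T)).mono_set Set.Ioc_subset_Icc_self
    refine hvi.mono' ((hae.pow 2).norm.prod_swap.integral_prod_right') ?_
    filter_upwards [ae_restrict_mem measurableSet_Ioc] with t ht
    rw [Real.norm_of_nonneg (integral_nonneg fun ω => norm_nonneg _)]
    simpa using hvb t ht.1.le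

/-- Fubini for the product of two square integrable processes. -/
theorem IsSquareIntegrablePath.integral_mul {f g : ℝ → Ω → ℝ} (hf : IsSquareIntegrablePath f μ)
    (hg : IsSquareIntegrablePath g μ) {T : ℝ} (hT : 0 ≤ T) :
    Integrable (fun ω => ∫ t in (0 : ℝ)..T, f t ω * g t ω) μ ∧
    IntervalIntegrable (fun t => ∫ ω, f t ω * g t ω ∂μ) volume 0 T ∧
    ∫ ω, (∫ t in (0 : ℝ)..T, f t ω * g t ω) ∂μ = ∫ t in (0 : ℝ)..T, ∫ ω, f t ω * g t ω ∂μ := by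
  have h := (hf.memLp_prod T).integrable_mul (hg.memLp_prod T)
  simp only [intervalIntegral.integral_of_le hT]
  refine ⟨h.integral_prod_left, ?_, integral_integral_swap (f := fun ω t => f t ω * g t ω) h⟩
  rw [intervalIntegrable_iff_integrableOn_Ioc_of_le hT]
  exact h.integral_prod_right

theorem IsSquareIntegrablePath.ae_intervalIntegrable_mul {f g : ℝ → Ω → ℝ}
    (hf : IsSquareIntegrablePath f μ)
    (hg : IsSquareIntegrablePath g μ) {T : ℝ} (hT : 0 ≤ T) :
    ∀ᵐ ω ∂μ, IntervalIntegrable (fun t => f t ω * g t ω) volume 0 T := by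
  have h := (hf.memLp_prod T).integrable_mul (hg.memLp_prod T)
  filter_upwards [h.prod_right_ae] with ω hω
  rw [intervalIntegrable_iff_integrableOn_Ioc_of_le hT]
  exact hω

/-- Cauchy–Schwarz against `1`: expand `∫ (f - c)² ≥ 0` and take `c` to be the mean of `f`; the zero
measure is treated separately. -/
theorem sq_integral_le {α : Type*} [MeasurableSpace α] {ν : Measure α} [IsFiniteMeasure ν]
    {f : α → ℝ} (hf : MemLp f 2 ν) : (∫ x, f x ∂ν) ^ 2 ≤ ν.real Set.univ * ∫ x, f x ^ 2 ∂ν := by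
  have h1 : Integrable f ν := hf.integrable (by norm_num)
  have h2 := hf.integrable_sq
  have h3 : ∀ c : ℝ, 0 ≤ (∫ x, f x ^ 2 ∂ν) - 2 * c * (∫ x, f x ∂ν) + c ^ 2 * ν.real Set.univ := by
    intro c
    have h4 : 0 ≤ ∫ x, (f x - c) ^ 2 ∂ν := integral_nonneg fun x => sq_nonneg _
    have h5 : ∀ x, (f x - c) ^ 2 = f x ^ 2 - 2 * c * f x + c ^ 2 := fun x => by ring
    simp_rw [h5] at h4
    rw [integral_add (f := fun x => f x ^ 2 - 2 * c * f x) (h2.sub (h1.const_mul _))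
      (integrable_const _), integral_sub h2 (h1.const_mul _), integral_const_mul,
      integral_const, smul_eq_mul] at h4
    linarith
  rcases (measureReal_nonneg (μ := ν) (s := Set.univ)).eq_or_lt with h0 | h0
  · have hν : ν = 0 := by
      rw [← Measure.measure_univ_eq_zero]
      exact (measureReal_eq_zero_iff).1 h0.symm
    simp [hν]
  · have h6 := h3 ((∫ x, f x ∂ν) / ν.real Set.univ)
    have h7 : (∫ x, f x ^ 2 ∂ν) - 2 * ((∫ x, f x ∂ν) / ν.real Set.univ) * (∫ x, f x ∂ν)
        + ((∫ x, f x ∂ν) / ν.real Set.univ) ^ 2 * ν.real Set.univ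
        = (ν.real Set.univ * (∫ x, f x ^ 2 ∂ν) - (∫ x, f x ∂ν) ^ 2) / ν.real Set.univ := by
      field_simp
      ring
    rw [h7] at h6
    have := (div_nonneg_iff.1 h6).resolve_right (fun h => absurd h.2 (not_le.2 h0))
    linarith [this.1]

theorem IsSquareIntegrablePath.memLp_integral {f : ℝ → Ω → ℝ} (hf : IsSquareIntegrablePath f μ)
    {T : ℝ} (hT : 0 ≤ T) :
    MemLp (fun ω => ∫ t in (0 : ℝ)..T, f t ω) 2 μ := by
  have h := hf.memLp_prod T
  simp only [intervalIntegral.integral_of_le hT]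
  have hae := h.aestronglyMeasurable.integral_prod_right'
  rw [memLp_two_iff_integrable_sq hae]
  have h2 := h.integrable_sq
  refine (h2.integral_prod_left.const_mul ((volume.restrict (Set.Ioc 0 T)).real Set.univ)).mono'
    (hae.pow 2) ?_
  filter_upwards [h2.prod_right_ae, h.aestronglyMeasurable.prodMk_left] with ω hω hω2
  rw [Real.norm_of_nonneg (sq_nonneg _)]
  exact sq_integral_le ((memLp_two_iff_integrable_sq hω2).2 hω)

/-- Cesàro averages of a convergent function converge to the same limit. -/
theorem tendsto_average {g : ℝ → ℝ} {l : ℝ} (hg : ∀ T, 0 ≤ T → IntervalIntegrable g volume 0 T)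
    (h : Tendsto g atTop (𝓝 l)) :
    Tendsto (fun T => 1 / T * ∫ t in (0 : ℝ)..T, g t) atTop (𝓝 l) := by
  rw [Metric.tendsto_atTop] at h ⊢
  intro ε hε
  obtain ⟨N, hN⟩ := h (ε / 2) (by positivity)
  set N₀ := max N 0
  set c := |∫ t in (0 : ℝ)..N₀, (g t - l)|
  -- The first bound keeps `T` positive and past `N₀`; the second makes the head at most `ε / 4`
  -- after division by `T`, and the tail contributes at most `ε / 2`.
  refine ⟨max (N₀ + 1) (4 * c / ε), fun T hT => ?_⟩
  have hT1 : N₀ + 1 ≤ T := (le_max_left _ _).trans hT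
  have hT2 : 4 * c / ε ≤ T := (le_max_right _ _).trans hT
  have hN0 : 0 ≤ N₀ := le_max_right _ _
  have hTpos : 0 < T := by linarith
  have hi : ∀ T, 0 ≤ T → IntervalIntegrable (fun t => g t - l) volume 0 T := fun T hT =>
    (hg T hT).sub intervalIntegrable_const
  have h1 : 1 / T * (∫ t in (0 : ℝ)..T, g t) - l = 1 / T * ∫ t in (0 : ℝ)..T, (g t - l) := by
    rw [intervalIntegral.integral_sub (hg T hTpos.le) intervalIntegrable_const,
      intervalIntegral.integral_const, smul_eq_mul]
    field_simp
    ring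
  have h2 := intervalIntegral.integral_add_adjacent_intervals (hi N₀ hN0)
    ((hi N₀ hN0).symm.trans (hi T hTpos.le))
  have h3 : ‖∫ t in N₀..T, (g t - l)‖ ≤ ε / 2 * |T - N₀| := by
    refine intervalIntegral.norm_integral_le_of_norm_le_const fun t ht => ?_
    rw [Set.uIoc_of_le (by linarith)] at ht
    exact (hN t ((le_max_left _ _).trans ht.1.le)).le
  rw [Real.dist_eq, h1, ← h2, abs_mul, abs_of_pos (by positivity), one_div, inv_mul_lt_iff₀ hTpos]
  rw [Real.norm_eq_abs, abs_of_pos (a := T - N₀) (by linarith)] at h3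
  rw [div_le_iff₀ hε] at hT2
  calc _ ≤ c + |∫ t in N₀..T, (g t - l)| := abs_add_le _ _
    _ ≤ c + ε / 2 * (T - N₀) := by gcongr
    _ < T * ε := by nlinarith

end SecondOrder

/-! ### Variation of constants and integration by parts -/

section Response

variable {ι : Type*} [Fintype ι] [DecidableEq ι]

omit [DecidableEq ι] in
theorem intervalIntegral_apply {f : ℝ → ι → ℝ} (hf : Continuous f) (a b : ℝ) (i : ι) :
    (∫ s in a..b, f s) i = ∫ s in a..b, f s i :=
  ((ContinuousLinearMap.proj (R := ℝ) (φ := fun _ : ι => ℝ) i).intervalIntegral_comp_comm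
    (hf.intervalIntegrable a b)).symm

theorem continuous_exp_sub_smul (M : Matrix ι ι ℝ) (t : ℝ) :
    Continuous fun s : ℝ => NormedSpace.exp ((t - s) • M) :=
  (continuous_exp_smul M).comp (continuous_const.sub continuous_id)

theorem linearResponse_apply (M : Matrix ι ι ℝ) (z₀ : ι → ℝ) {η : ℝ → ι → ℝ} (hη : Continuous η)
    (t : ℝ) (i : ι) :
    linearResponse M z₀ η t i = (NormedSpace.exp (t • M) *ᵥ z₀) i + η t i
      + ∑ j, ∫ s in (0 : ℝ)..t, (NormedSpace.exp ((t - s) • M) * M) i j * η s j := by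
  have hE : Continuous fun s : ℝ => NormedSpace.exp ((t - s) • M) * M :=
    (continuous_exp_sub_smul M t).matrix_mul continuous_const
  have hc : Continuous fun s : ℝ => (NormedSpace.exp ((t - s) • M) * M) *ᵥ η s :=
    hE.matrix_mulVec hη
  rw [linearResponse, Pi.add_apply, Pi.add_apply]
  simp_rw [Matrix.mulVec_mulVec]
  rw [intervalIntegral_apply hc]
  exact congrArg _ (intervalIntegral.integral_finsetSum fun j _ =>
    ((hE.matrix_elem i j).mul ((continuous_apply j).comp hη)).intervalIntegrable _ _)

theorem hasDerivAt_exp_sub_mulVec (M : Matrix ι ι ℝ) {g : ℝ → ι → ℝ} {g' : ι → ℝ} (t s : ℝ)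
    (hg : HasDerivAt g g' s) :
    HasDerivAt (fun s => NormedSpace.exp ((t - s) • M) *ᵥ g s)
      (NormedSpace.exp ((t - s) • M) *ᵥ g' - NormedSpace.exp ((t - s) • M) *ᵥ (M *ᵥ g s)) s := by
  have hg2 : HasDerivAt (fun r => g (t - r)) (-g') (t - s) := by
    have h1 : HasDerivAt (fun r : ℝ => t - r) (-1) (t - s) := by
      simpa using (hasDerivAt_id (t - s)).const_sub t
    have h0 : HasDerivAt g g' (t - (t - s)) := by rwa [sub_sub_cancel]
    exact (h0.scomp (t - s) h1).congr_deriv (by simp)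
  have h2 := hasDerivAt_exp_mulVec M _ _ (t - s) hg2
  have h3 : HasDerivAt (fun r : ℝ => t - r) (-1) s := by
    simpa using (hasDerivAt_id s).const_sub t
  have h4 := h2.scomp s h3
  simp only [Function.comp_def, sub_sub_cancel] at h4
  refine h4.congr_deriv ?_
  have hcomm : M * NormedSpace.exp ((t - s) • M) = NormedSpace.exp ((t - s) • M) * M :=
    (((Commute.refl M).smul_right (t - s)).exp_right).eq
  rw [Matrix.mulVec_mulVec, hcomm, ← Matrix.mulVec_mulVec, Matrix.mulVec_neg]
  simp [sub_eq_add_neg, add_comm]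

/-- Integration by parts, trading `M` for the derivative of the drive. It turns `linearResponse`
into the usual convolution when the drive is differentiable. -/
theorem integral_exp_sub_mulVec (M : Matrix ι ι ℝ) {g g' : ℝ → ι → ℝ} (t a b : ℝ)
    (hg : ∀ s, HasDerivAt g (g' s) s) (hg' : Continuous g') :
    ∫ s in a..b, NormedSpace.exp ((t - s) • M) *ᵥ (M *ᵥ g s)
      = (∫ s in a..b, NormedSpace.exp ((t - s) • M) *ᵥ g' s)
        + NormedSpace.exp ((t - a) • M) *ᵥ g a - NormedSpace.exp ((t - b) • M) *ᵥ g b := by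
  have hgc : Continuous g := continuous_iff_continuousAt.2 fun s => (hg s).continuousAt
  have h1 : Continuous fun s => NormedSpace.exp ((t - s) • M) *ᵥ g' s :=
    (continuous_exp_sub_smul M t).matrix_mulVec hg'
  have h2 : Continuous fun s => NormedSpace.exp ((t - s) • M) *ᵥ (M *ᵥ g s) :=
    (continuous_exp_sub_smul M t).matrix_mulVec (continuous_const.matrix_mulVec hgc)
  have h3 := intervalIntegral.integral_eq_sub_of_hasDerivAt (a := a) (b := b)
    (fun s _ => hasDerivAt_exp_sub_mulVec M t s (hg s)) ((h1.sub h2).intervalIntegrable a b)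
  rw [intervalIntegral.integral_sub (h1.intervalIntegrable _ _) (h2.intervalIntegrable _ _)] at h3
  rw [sub_eq_iff_eq_add] at h3
  rw [h3]
  abel

theorem linearResponse_of_hasDerivAt (M : Matrix ι ι ℝ) {g g' : ℝ → ι → ℝ} (t : ℝ)
    (hg : ∀ s, HasDerivAt g (g' s) s) (hg' : Continuous g') (h0 : g 0 = 0) :
    linearResponse M 0 g t = ∫ s in (0 : ℝ)..t, NormedSpace.exp ((t - s) • M) *ᵥ g' s := by
  rw [linearResponse, integral_exp_sub_mulVec M t 0 t hg hg', h0]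
  simp

/-- The Brownian covariance `s ↦ min s r` is a ramp with a kink at `r`. Integrating by parts on each
side, the slope is `c` before `r` and `0` after it, and the boundary terms cancel. -/
theorem linearResponse_min (M : Matrix ι ι ℝ) (c : ι → ℝ) {r t : ℝ} (hr : 0 ≤ r) (hrt : r ≤ t) :
    linearResponse M 0 (fun s => min s r • c) t
      = ∫ s in (0 : ℝ)..r, NormedSpace.exp ((t - s) • M) *ᵥ c := by
  have hcont : Continuous fun s => NormedSpace.exp ((t - s) • M) *ᵥ (M *ᵥ (min s r • c)) :=
    (continuous_exp_sub_smul M t).matrix_mulVec (continuous_const.matrix_mulVec (by fun_prop))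
  have h1 : ∫ s in (0 : ℝ)..r, NormedSpace.exp ((t - s) • M) *ᵥ (M *ᵥ (min s r • c))
      = ∫ s in (0 : ℝ)..r, NormedSpace.exp ((t - s) • M) *ᵥ (M *ᵥ (s • c)) := by
    refine intervalIntegral.integral_congr fun s hs => ?_
    rw [Set.uIcc_of_le hr] at hs
    simp only [min_eq_left hs.2]
  have h2 : ∫ s in r..t, NormedSpace.exp ((t - s) • M) *ᵥ (M *ᵥ (min s r • c))
      = ∫ s in r..t, NormedSpace.exp ((t - s) • M) *ᵥ (M *ᵥ (r • c)) := by
    refine intervalIntegral.integral_congr fun s hs => ?_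
    rw [Set.uIcc_of_le hrt] at hs
    simp only [min_eq_right hs.1]
  rw [linearResponse, ← intervalIntegral.integral_add_adjacent_intervals
    (hcont.intervalIntegrable 0 r) (hcont.intervalIntegrable r t), h1, h2,
    integral_exp_sub_mulVec M (g := fun s => s • c) (g' := fun _ => c) t 0 r
      (fun s => by simpa using (hasDerivAt_id s).smul_const c) continuous_const,
    integral_exp_sub_mulVec M (g := fun _ => r • c) (g' := fun _ => 0) t r t
      (fun s => hasDerivAt_const s _) continuous_const]
  simp [min_eq_right hrt]

end Response

/-! ### Second moments of the response to white noise -/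

section Noise

variable {ι : Type*} [Fintype ι] [DecidableEq ι] {Ω : Type*} [MeasurableSpace Ω] {μ : Measure Ω}

/-- The second order properties of a Brownian path with intensity `W`. -/
structure IsNoise (η : Ω → ℝ → ι → ℝ) (W : Matrix ι ι ℝ) (μ : Measure Ω) : Prop where
  cont : ∀ ω, Continuous (η ω)
  meas : ∀ t i, Measurable fun ω => η ω t i
  memLp : ∀ t, 0 ≤ t → ∀ i, MemLp (fun ω => η ω t i) 2 μ
  cov : ∀ s r, 0 ≤ s → 0 ≤ r → ∀ i j, ∫ ω, η ω s i * η ω r j ∂μ = min s r * W i j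

variable {η : Ω → ℝ → ι → ℝ} {W : Matrix ι ι ℝ}

omit [Fintype ι] [DecidableEq ι] in
theorem IsNoise.isSquareIntegrablePath (h : IsNoise η W μ) (i : ι) :
    IsSquareIntegrablePath (fun t ω => η ω t i) μ :=
  .of_continuous (fun t => h.meas t i) (fun ω => (continuous_apply i).comp (h.cont ω))
    (fun t ht => h.memLp t ht i) ⟨fun t => t * W i i, by fun_prop, fun t ht => by
      have := h.cov t t ht ht i i
      simp_rw [pow_two]
      rw [this, min_self]⟩

variable [IsProbabilityMeasure μ]

theorem IsNoise.memLp_linearResponse (h : IsNoise η W μ) (M : Matrix ι ι ℝ) {t : ℝ} (ht : 0 ≤ t)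
    (i : ι) : MemLp (fun ω => linearResponse M 0 (η ω) t i) 2 μ := by
  simp_rw [fun ω => linearResponse_apply M 0 (h.cont ω) t i, Matrix.mulVec_zero, Pi.zero_apply,
    zero_add]
  have hE : Continuous fun s : ℝ => NormedSpace.exp ((t - s) • M) * M :=
    (continuous_exp_sub_smul M t).matrix_mul continuous_const
  exact (h.memLp t ht i).add (memLp_finsetSum _ fun j _ =>
    ((h.isSquareIntegrablePath j).mul_continuous (hE.matrix_elem i j)).memLp_integral ht)

/-- Correlations of a linear response with a square integrable variable. -/
theorem IsNoise.integral_linearResponse_mul (h : IsNoise η W μ) (M : Matrix ι ι ℝ) {t : ℝ}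
    (ht : 0 ≤ t) {Z : Ω → ℝ} (hZ : MemLp Z 2 μ) {g : ℝ → ι → ℝ} (hg : Continuous g)
    (hgZ : ∀ s, 0 ≤ s → s ≤ t → ∀ j, ∫ ω, η ω s j * Z ω ∂μ = g s j) (i : ι) :
    ∫ ω, linearResponse M 0 (η ω) t i * Z ω ∂μ = linearResponse M 0 g t i := by
  simp_rw [fun ω => linearResponse_apply M 0 (h.cont ω) t i, linearResponse_apply M 0 hg t i,
    Matrix.mulVec_zero, Pi.zero_apply, zero_add, add_mul, Finset.sum_mul]
  have hE : Continuous fun s : ℝ => NormedSpace.exp ((t - s) • M) * M :=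
    (continuous_exp_sub_smul M t).matrix_mul continuous_const
  have hp : ∀ j, IsSquareIntegrablePath
      (fun s ω => (NormedSpace.exp ((t - s) • M) * M) i j * η ω s j) μ := fun j =>
    (h.isSquareIntegrablePath j).mul_continuous (hE.matrix_elem i j)
  have hI : ∀ j, Integrable (fun ω =>
      (∫ s in (0 : ℝ)..t, (NormedSpace.exp ((t - s) • M) * M) i j * η ω s j) * Z ω) μ := fun j =>
    ((hp j).memLp_integral ht).integrable_mul hZ
  rw [integral_add (f := fun ω => η ω t i * Z ω) ((h.memLp t ht i).integrable_mul hZ)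
      (integrable_finsetSum _ fun j _ => hI j),
    integral_finsetSum _ fun j _ => hI j, hgZ t ht le_rfl]
  congr 1
  refine Finset.sum_congr rfl fun j _ => ?_
  simp_rw [← intervalIntegral.integral_mul_const]
  rw [((hp j).integral_mul (.const hZ) ht).2.2]
  refine intervalIntegral.integral_congr fun s hs => ?_
  rw [Set.uIcc_of_le ht] at hs
  simp_rw [mul_assoc]
  rw [integral_const_mul, hgZ s hs.1 hs.2]

/-- By linearity, correlating the response with `η_s` is the response to the correlation of the
drive with `η_s`, which is the ramp `min r s`. -/
theorem IsNoise.integral_linearResponse_mul_noise (h : IsNoise η W μ) (M : Matrix ι ι ℝ) {s t : ℝ}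
    (hs : 0 ≤ s) (hst : s ≤ t) (i j : ι) :
    ∫ ω, linearResponse M 0 (η ω) t i * η ω s j ∂μ
      = ∫ r in (0 : ℝ)..s, (NormedSpace.exp ((t - r) • M) * W) i j := by
  rw [h.integral_linearResponse_mul M (hs.trans hst) (h.memLp s hs j)
    (g := fun r => min r s • fun k => W k j) (by fun_prop)
    (fun r hr _ k => by simpa using h.cov r s hr hs k j), linearResponse_min M _ hs hst,
    intervalIntegral_apply ((continuous_exp_sub_smul M t).matrix_mulVec continuous_const)]
  rfl

/-- The covariance of the linear response to white noise, in terms of the stationary covariance. -/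
theorem IsNoise.integral_linearResponse_mul_linearResponse (h : IsNoise η W μ)
    {M X : Matrix ι ι ℝ} (hX : M * X + X * Mᵀ + W = 0) {t : ℝ} (ht : 0 ≤ t) (i k : ι) :
    ∫ ω, linearResponse M 0 (η ω) t k * linearResponse M 0 (η ω) t i ∂μ
      = (X - NormedSpace.exp (t • M) * X * NormedSpace.exp (t • Mᵀ)) i k := by
  have hE : Continuous fun s : ℝ => NormedSpace.exp ((t - s) • M) * W :=
    (continuous_exp_sub_smul M t).matrix_mul continuous_const
  have hd : ∀ s, HasDerivAt
      (fun s => fun j => ∫ r in (0 : ℝ)..s, (NormedSpace.exp ((t - r) • M) * W) i j)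
      (fun j => (NormedSpace.exp ((t - s) • M) * W) i j) s := fun s =>
    hasDerivAt_pi.2 fun j => ((hE.matrix_elem i j).integral_hasStrictDerivAt 0 s).hasDerivAt
  have hd' : Continuous fun s : ℝ => fun j => (NormedSpace.exp ((t - s) • M) * W) i j :=
    continuous_pi fun j => hE.matrix_elem i j
  -- The expectation passes through the response a second time, now against the response itself. The
  -- resulting drive is differentiable in `s`, so only a convolution remains.
  rw [h.integral_linearResponse_mul M ht (h.memLp_linearResponse M ht i)
    (g := fun s => fun j => ∫ r in (0 : ℝ)..s, (NormedSpace.exp ((t - r) • M) * W) i j)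
    (continuous_iff_continuousAt.2 fun s => (hd s).continuousAt)
    (fun s hs hst j => by
      simp_rw [mul_comm (η _ s j)]
      exact h.integral_linearResponse_mul_noise M hs hst i j),
    linearResponse_of_hasDerivAt M t hd hd' (by ext j; simp),
    intervalIntegral_apply ((continuous_exp_sub_smul M t).matrix_mulVec hd')]
  -- The Lyapunov equation supplies an antiderivative of the integrand `e^{(t-s)M} W e^{(t-s)Mᵀ}`,
  -- so the integral is a difference of endpoint values.
  have hF : ∀ s : ℝ, HasDerivAt (fun s => (NormedSpace.exp ((t - s) • M) * X *
      NormedSpace.exp ((t - s) • Mᵀ)) i k)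
      ((NormedSpace.exp ((t - s) • M) *ᵥ fun j => (NormedSpace.exp ((t - s) • M) * W) i j) k)
      s := by
    intro s
    have h1 := hasDerivAt_pi.1 (hasDerivAt_pi.1 (hasDerivAt_exp_mul_mul_exp M X Mᵀ (t - s)) i) k
    have h3 : HasDerivAt (fun r : ℝ => t - r) (-1) s := by
      simpa using (hasDerivAt_id s).const_sub t
    refine (h1.scomp s h3).congr_deriv ?_
    rw [eq_neg_of_add_eq_zero_left hX, exp_smul_transpose, mul_neg, neg_mul, Matrix.neg_apply,
      smul_neg, neg_smul, one_smul, neg_neg, Matrix.mul_apply]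
    simp [Matrix.mulVec, dotProduct, mul_comm]
  rw [intervalIntegral.integral_eq_sub_of_hasDerivAt (fun s _ => hF s)
    (Continuous.intervalIntegrable ?_ _ _)]
  · simp
  · exact (continuous_apply k).comp ((continuous_exp_sub_smul M t).matrix_mulVec hd')

end Noise

theorem integrable_mul_of_memLp_two {α : Type*} [MeasurableSpace α] {ν : Measure α} {f g : α → ℝ}
    (hf : MemLp f 2 ν) (hg : MemLp g 2 ν) : Integrable (fun x => f x * g x) ν :=
  hf.integrable_mul hg

/-! ### Moments of Brownian motion -/

section GaussianMoments

variable {ι : Type*} [Fintype ι] [DecidableEq ι] {Ω : Type*} [MeasurableSpace Ω] {μ : Measure Ω}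

theorem memLp_eval_multivariateGaussian (S : Matrix ι ι ℝ) (i : ι) :
    MemLp (fun x : EuclideanSpace ℝ ι => x i) 2 (multivariateGaussian 0 S) :=
  IsGaussian.memLp_two_id.continuousLinearMap_comp (EuclideanSpace.proj (𝕜 := ℝ) i)

theorem integral_eval_multivariateGaussian (S : Matrix ι ι ℝ) (i : ι) :
    ∫ x : EuclideanSpace ℝ ι, x i ∂(multivariateGaussian 0 S) = 0 := by
  have := (EuclideanSpace.proj (𝕜 := ℝ) i).integral_comp_comm
    (IsGaussian.integrable_fun_id (μ := multivariateGaussian (0 : EuclideanSpace ℝ ι) S))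
  rw [integral_id_multivariateGaussian] at this
  simpa using this

theorem integral_eval_mul_eval_multivariateGaussian {S : Matrix ι ι ℝ} (hS : S.PosSemidef)
    (i j : ι) : ∫ x : EuclideanSpace ℝ ι, x i * x j ∂(multivariateGaussian 0 S) = S i j := by
  have h := covariance_eval_multivariateGaussian (μ := (0 : EuclideanSpace ℝ ι)) hS i j
  rw [covariance_eq_sub (memLp_eval_multivariateGaussian S i)
    (memLp_eval_multivariateGaussian S j), integral_eval_multivariateGaussian, zero_mul,
    sub_zero] at h
  exact h

variable {β : ℝ≥0 → Ω → EuclideanSpace ℝ ι} {S : Matrix ι ι ℝ}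

theorem IsBrownianWithIntensity.memLp_sub (h : IsBrownianWithIntensity β S μ) {s t : ℝ≥0}
    (hst : s ≤ t) (i : ι) : MemLp (fun ω => (β t - β s) ω i) 2 μ := by
  have hl := h.law s t hst
  refine MemLp.comp_of_map (f := β t - β s) (g := fun x : EuclideanSpace ℝ ι => x i) ?_
    hl.aemeasurable
  rw [hl.map_eq]
  exact memLp_eval_multivariateGaussian _ i

theorem IsBrownianWithIntensity.integral_sub (h : IsBrownianWithIntensity β S μ) {s t : ℝ≥0}
    (hst : s ≤ t) (i : ι) : ∫ ω, (β t - β s) ω i ∂μ = 0 :=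
  ((h.law s t hst).integral_comp (f := fun x : EuclideanSpace ℝ ι => x i)
    (memLp_eval_multivariateGaussian _ i).aestronglyMeasurable).trans
    (integral_eval_multivariateGaussian _ i)

theorem IsBrownianWithIntensity.sub_zero_eq (h : IsBrownianWithIntensity β S μ) (t : ℝ≥0) :
    β t - β 0 = β t := by
  ext ω
  simp [h.zero ω]

theorem IsBrownianWithIntensity.memLp (h : IsBrownianWithIntensity β S μ) (t : ℝ≥0) (i : ι) :
    MemLp (fun ω => β t ω i) 2 μ := by
  have := h.memLp_sub (zero_le (a := t)) i
  rwa [h.sub_zero_eq] at this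

theorem IsBrownianWithIntensity.integral_eq_zero (h : IsBrownianWithIntensity β S μ) (t : ℝ≥0)
    (i : ι) : ∫ ω, β t ω i ∂μ = 0 := by
  have := h.integral_sub (zero_le (a := t)) i
  rwa [h.sub_zero_eq] at this

theorem IsBrownianWithIntensity.integral_mul_self (h : IsBrownianWithIntensity β S μ)
    (hS : S.PosSemidef) (t : ℝ≥0) (i j : ι) : ∫ ω, β t ω i * β t ω j ∂μ = t * S i j := by
  have hl := h.law 0 t zero_le
  rw [h.sub_zero_eq] at hl
  have hps : (((t : ℝ) - ((0 : ℝ≥0) : ℝ)) • S).PosSemidef := hS.smul (by simp)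
  have h1 := (hl.integral_comp (f := fun x : EuclideanSpace ℝ ι => x i * x j)
    ((memLp_eval_multivariateGaussian _ i).integrable_mul
      (memLp_eval_multivariateGaussian _ j)).aestronglyMeasurable).trans
    (integral_eval_mul_eval_multivariateGaussian hps i j)
  simpa using h1

/-- For `s ≤ r`, write `β r` as `β s` plus an increment that is independent of `β s` and centred, so
only the variance at the earlier time survives. -/
theorem IsBrownianWithIntensity.integral_mul [IsProbabilityMeasure μ]
    (h : IsBrownianWithIntensity β S μ)
    (hS : S.PosSemidef) (s r : ℝ≥0) (i j : ι) :
    ∫ ω, β s ω i * β r ω j ∂μ = min (s : ℝ) r * S i j := by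
  have key : ∀ (s r : ℝ≥0), s ≤ r → ∀ i j, ∫ ω, β s ω i * β r ω j ∂μ = s * S i j := by
    intro s r hsr i j
    have h1 : ∀ ω, β s ω i * β r ω j = β s ω i * β s ω j + β s ω i * (β r - β s) ω j := by
      intro ω
      simp only [Pi.sub_apply, PiLp.sub_apply]
      ring
    have hind := h.indep.indepFun_eval_sub zero_le hsr (ae_of_all _ h.zero)
    have hind2 : IndepFun (fun ω => β s ω i) (fun ω => (β r - β s) ω j) μ :=
      hind.comp (φ := fun x : EuclideanSpace ℝ ι => x i) (ψ := fun x : EuclideanSpace ℝ ι => x j)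
        (by fun_prop) (by fun_prop)
    simp_rw [h1]
    rw [integral_add (integrable_mul_of_memLp_two (h.memLp s i) (h.memLp s j))
      (integrable_mul_of_memLp_two (h.memLp s i) (h.memLp_sub hsr j)), h.integral_mul_self hS,
      hind2.integral_fun_mul_eq_mul_integral (h.memLp s i).aestronglyMeasurable
        (h.memLp_sub hsr j).aestronglyMeasurable, h.integral_sub hsr, mul_zero, add_zero]
  rcases le_total s r with hsr | hsr
  · rw [key s r hsr, min_eq_left (by exact_mod_cast hsr)]
  · simp_rw [mul_comm (β s _ i)]
    have hSt : S j i = S i j := by simpa using hS.isHermitian.apply i j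
    rw [key r s hsr, min_eq_right (by exact_mod_cast hsr), hSt]

end GaussianMoments

/-! ### The noise entering the closed loop -/

section ClosedLoopNoise

variable {n m p : ℕ} {Ω : Type*} [MeasurableSpace Ω] {μ : Measure Ω} [IsProbabilityMeasure μ]

/-- The intensity `diag(W, B_K V B_Kᵀ)` of the noise entering the closed loop. -/
noncomputable def Problem.noiseIntensity (S : Problem n m p) (K : Controller n m p) :
    Matrix (Fin n ⊕ Fin n) (Fin n ⊕ Fin n) ℝ :=
  Matrix.fromBlocks S.W 0 0 (Controller.BK K * S.V * (Controller.BK K)ᵀ)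

/-- The off-diagonal blocks vanish because `w` and `v` are independent and centred; the lower block
comes from bilinearity in `B_K`. -/
theorem Problem.isNoise_closedLoopNoise (S : Problem n m p) (hW : S.W.PosSemidef)
    (hV : S.V.PosSemidef) {w : ℝ≥0 → Ω → EuclideanSpace ℝ (Fin n)}
    {v : ℝ≥0 → Ω → EuclideanSpace ℝ (Fin p)}
    (hw : IsBrownianWithIntensity w S.W μ) (hv : IsBrownianWithIntensity v S.V μ)
    (hwv : IndepFun (fun ω t => w t ω) (fun ω t => v t ω) μ) (K : Controller n m p) :
    IsNoise (closedLoopNoise w v K) (S.noiseIntensity K) μ := by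
  have hBv : ∀ t i ω, closedLoopNoise w v K ω t (Sum.inr i)
      = ∑ k, Controller.BK K i k * v t.toNNReal ω k := fun t i ω => rfl
  have hw0 : ∀ t i ω, closedLoopNoise w v K ω t (Sum.inl i) = w t.toNNReal ω i :=
    fun t i ω => rfl
  have hind : ∀ s r i k, ∫ ω, w s ω i * v r ω k ∂μ = 0 := by
    intro s r i k
    have h2 : IndepFun (fun ω => w s ω i) (fun ω => v r ω k) μ :=
      hwv.comp (φ := fun f : ℝ≥0 → EuclideanSpace ℝ (Fin n) => f s i)
        (ψ := fun f : ℝ≥0 → EuclideanSpace ℝ (Fin p) => f r k) (by fun_prop) (by fun_prop)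
    rw [h2.integral_fun_mul_eq_mul_integral (hw.memLp s i).aestronglyMeasurable
      (hv.memLp r k).aestronglyMeasurable, hw.integral_eq_zero, zero_mul]
  have hcross : ∀ s r i j,
      ∫ ω, w s ω i * ∑ k, Controller.BK K j k * v r ω k ∂μ = 0 := by
    intro s r i j
    simp_rw [Finset.mul_sum, mul_left_comm]
    rw [integral_finsetSum _ fun k _ =>
      (integrable_mul_of_memLp_two (hw.memLp s i) (hv.memLp r k)).const_mul _]
    simp_rw [integral_const_mul, hind, mul_zero, Finset.sum_const_zero]
  constructor
  · intro ω
    refine continuous_pi fun i => ?_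
    rcases i with i | i
    · simp_rw [hw0]
      have := (hw.continuous ω).comp continuous_real_toNNReal
      exact (EuclideanSpace.proj (𝕜 := ℝ) i).continuous.comp this
    · simp_rw [hBv]
      have := (hv.continuous ω).comp continuous_real_toNNReal
      exact continuous_finsetSum _ fun k _ => continuous_const.mul
        ((EuclideanSpace.proj (𝕜 := ℝ) k).continuous.comp this)
  · intro t i
    have hwm := hw.measurable t.toNNReal
    have hvm := hv.measurable t.toNNReal
    rcases i with i | i
    · simp_rw [hw0]
      fun_prop
    · simp_rw [hBv]
      fun_prop
  · intro t _ i
    rcases i with i | i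
    · simp_rw [hw0]
      exact hw.memLp _ i
    · simp_rw [hBv]
      exact memLp_finsetSum _ fun k _ => (hv.memLp _ k).const_mul _
  · intro s r hs hr i j
    rcases i with i | i <;> rcases j with j | j
    · simp_rw [hw0]
      rw [hw.integral_mul hW, Real.coe_toNNReal _ hs, Real.coe_toNNReal _ hr]
      rfl
    · simp_rw [hw0, hBv, hcross]
      simp [Problem.noiseIntensity]
    · simp_rw [hw0, hBv, mul_comm _ (w _ _ _), hcross]
      simp [Problem.noiseIntensity]
    · simp_rw [hBv, Finset.sum_mul_sum]
      have hi : ∀ k l, Integrable (fun ω => Controller.BK K i k * v s.toNNReal ω k *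
          (Controller.BK K j l * v r.toNNReal ω l)) μ := fun k l =>
        ((hv.memLp _ k).const_mul _).integrable_mul ((hv.memLp _ l).const_mul _)
      rw [integral_finsetSum _ fun k _ => integrable_finsetSum _ fun l _ => hi k l]
      simp_rw [integral_finsetSum _ fun l _ => hi _ l, mul_mul_mul_comm, integral_const_mul,
        hv.integral_mul hV, Real.coe_toNNReal _ hs, Real.coe_toNNReal _ hr]
      simp only [Problem.noiseIntensity, Matrix.fromBlocks_apply₂₂, Matrix.mul_apply,
        Matrix.transpose_apply, Finset.mul_sum, Finset.sum_mul]
      rw [Finset.sum_comm]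
      refine Finset.sum_congr rfl fun l _ => Finset.sum_congr rfl fun k _ => ?_
      ring

end ClosedLoopNoise

/-! ### Convergence of the closed-loop covariance -/

section StationaryCovariance

variable {ι : Type*} [Fintype ι] [DecidableEq ι] {Ω : Type*} [MeasurableSpace Ω] {μ : Measure Ω}
  [IsProbabilityMeasure μ] {η : Ω → ℝ → ι → ℝ} {W : Matrix ι ι ℝ}

theorem linearResponse_eq_add (M : Matrix ι ι ℝ) (z₀ : ι → ℝ) (η : ℝ → ι → ℝ) (t : ℝ) :
    linearResponse M z₀ η t = NormedSpace.exp (t • M) *ᵥ z₀ + linearResponse M 0 η t := by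
  simp [linearResponse, add_assoc]

omit [IsProbabilityMeasure μ] in
theorem IsNoise.measurable_linearResponse (h : IsNoise η W μ) (M : Matrix ι ι ℝ) (t : ℝ) (i : ι) :
    Measurable fun ω => linearResponse M 0 (η ω) t i := by
  simp_rw [fun ω => linearResponse_apply M 0 (h.cont ω) t i]
  have hE : Continuous fun s : ℝ => NormedSpace.exp ((t - s) • M) * M :=
    (continuous_exp_sub_smul M t).matrix_mul continuous_const
  refine ((measurable_const.add (h.meas t i))).add (Finset.measurable_sum _ fun j _ => ?_)
  have h1 : Measurable fun q : Ω × ℝ =>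
      (NormedSpace.exp ((t - q.2) • M) * M) i j * η q.1 q.2 j :=
    ((hE.matrix_elem i j).measurable.comp measurable_snd).mul
      ((measurable_uncurry_of_continuous_of_measurable (u := fun s ω => η ω s j)
        (fun ω => (continuous_apply j).comp (h.cont ω)) (fun s => h.meas s j)).comp
          measurable_swap)
  simp only [intervalIntegral]
  exact (h1.stronglyMeasurable.integral_prod_right'.measurable).sub
    (h1.stronglyMeasurable.integral_prod_right'.measurable)

theorem IsNoise.isSquareIntegrablePath_linearResponse_zero (h : IsNoise η W μ) {M : Matrix ι ι ℝ}
    (hM : IsStable M) (i : ι) :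
    IsSquareIntegrablePath (fun t ω => linearResponse M 0 (η ω) t i) μ := by
  refine .of_continuous (fun t => h.measurable_linearResponse M t i)
    (fun ω => (continuous_apply i).comp (linearResponse_spec M 0 (h.cont ω)).1)
    (fun t ht => h.memLp_linearResponse M ht i)
    ⟨fun t => (lyapunovSol M W - NormedSpace.exp (t • M) * lyapunovSol M W *
      NormedSpace.exp (t • Mᵀ)) i i, ?_, fun t ht => ?_⟩
  · exact (continuous_const.sub (((continuous_exp_smul M).matrix_mul continuous_const).matrix_mul
      (continuous_exp_smul Mᵀ))).matrix_elem i i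
  · simp_rw [pow_two]
    rw [h.integral_linearResponse_mul_linearResponse (hM.lyapunovSol_spec W) ht]

theorem IsNoise.isSquareIntegrablePath_linearResponse (h : IsNoise η W μ) {M : Matrix ι ι ℝ}
    (hM : IsStable M) {z₀ : Ω → ι → ℝ} (hz₀ : ∀ i, MemLp (fun ω => z₀ ω i) 2 μ) (i : ι) :
    IsSquareIntegrablePath (fun t ω => linearResponse M (z₀ ω) (η ω) t i) μ := by
  simp_rw [fun ω t => linearResponse_eq_add M (z₀ ω) (η ω) t, Pi.add_apply]
  exact (IsSquareIntegrablePath.sum _ fun j => (IsSquareIntegrablePath.const (hz₀ j)).mul_continuous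
    ((continuous_exp_smul M).matrix_elem i j)).add
      (h.isSquareIntegrablePath_linearResponse_zero hM i)

-- The initial state may be correlated with the noise, so the cross terms need not be zero. They
-- still decay: each is a decaying coefficient times a correlation bounded through `|ab| ≤ a² + b²`.
omit [IsProbabilityMeasure μ] in
theorem tendsto_integral_decay {M : Matrix ι ι ℝ} (hM : IsStable M) {z₀ : Ω → ι → ℝ}
    (hz₀ : ∀ i, MemLp (fun ω => z₀ ω i) 2 μ) {Y : ℝ → Ω → ℝ} (hY : ∀ t, 0 ≤ t → MemLp (Y t) 2 μ)
    {c : ℝ} (hc : ∀ t, 0 ≤ t → ∫ ω, Y t ω ^ 2 ∂μ ≤ c) (i : ι) :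
    Tendsto (fun t => ∫ ω, (NormedSpace.exp (t • M) *ᵥ z₀ ω) i * Y t ω ∂μ) atTop (𝓝 0) := by
  have h1 : Tendsto (fun t => ∑ j, NormedSpace.exp (t • M) i j * ∫ ω, z₀ ω j * Y t ω ∂μ)
      atTop (𝓝 0) := by
    rw [← Finset.sum_const_zero (s := (Finset.univ : Finset ι))]
    refine tendsto_finsetSum _ fun j _ => ?_
    have h2 : Tendsto (fun t : ℝ => NormedSpace.exp (t • M) i j) atTop (𝓝 0) :=
      tendsto_pi_nhds.1 (tendsto_pi_nhds.1 hM.tendsto_exp i) j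
    refine h2.zero_mul_isBoundedUnder_le ?_
    refine isBoundedUnder_of_eventually_le (a := (∫ ω, z₀ ω j ^ 2 ∂μ) + c) ?_
    filter_upwards [eventually_ge_atTop 0] with t ht
    have hi := integrable_mul_of_memLp_two (hz₀ j) (hY t ht)
    refine (norm_integral_le_integral_norm _).trans ?_
    calc ∫ ω, ‖z₀ ω j * Y t ω‖ ∂μ ≤ ∫ ω, z₀ ω j ^ 2 + Y t ω ^ 2 ∂μ :=
          integral_mono hi.norm ((hz₀ j).integrable_sq.add (hY t ht).integrable_sq) fun ω => by
            rw [Real.norm_eq_abs, abs_mul]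
            nlinarith [sq_nonneg (|z₀ ω j| - |Y t ω|), sq_abs (z₀ ω j), sq_abs (Y t ω),
              sq_nonneg (z₀ ω j), sq_nonneg (Y t ω)]
      _ = (∫ ω, z₀ ω j ^ 2 ∂μ) + ∫ ω, Y t ω ^ 2 ∂μ :=
          integral_add (hz₀ j).integrable_sq (hY t ht).integrable_sq
      _ ≤ _ := by linarith [hc t ht]
  refine h1.congr' ?_
  filter_upwards [eventually_ge_atTop 0] with t ht
  simp only [Matrix.mulVec, dotProduct, Finset.sum_mul, mul_assoc]
  rw [integral_finsetSum _ fun j _ => (integrable_mul_of_memLp_two (hz₀ j) (hY t ht)).const_mul _]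
  simp_rw [integral_const_mul]

/-- The covariance of the state converges to the solution of the Lyapunov equation. -/
theorem IsNoise.tendsto_integral_mul (h : IsNoise η W μ) {M : Matrix ι ι ℝ}
    (hM : IsStable M) (hW : W.PosSemidef) {z₀ : Ω → ι → ℝ}
    (hz₀ : ∀ i, MemLp (fun ω => z₀ ω i) 2 μ) (i k : ι) :
    Tendsto (fun t => ∫ ω, linearResponse M (z₀ ω) (η ω) t k * linearResponse M (z₀ ω) (η ω) t i ∂μ)
      atTop (𝓝 (lyapunovSol M W i k)) := by
  have hX := hM.lyapunovSol_spec W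
  set X := lyapunovSol M W
  have hXp := hM.posSemidef_of_lyapunov hW hX
  have hy : ∀ (t : ℝ) j, MemLp (fun ω => (NormedSpace.exp (t • M) *ᵥ z₀ ω) j) 2 μ := fun t j =>
    memLp_finsetSum _ fun l _ => (hz₀ l).const_mul (NormedSpace.exp (t • M) j l)
  have hζ : ∀ t, 0 ≤ t → ∀ j, MemLp (fun ω => linearResponse M 0 (η ω) t j) 2 μ :=
    fun t ht j => h.memLp_linearResponse M ht j
  -- A bound uniform in time: the covariance is `X` minus the positive semidefinite matrix `e^{tM} X
  -- e^{tMᵀ}`.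
  have hζ2 : ∀ j t, 0 ≤ t → ∫ ω, linearResponse M 0 (η ω) t j ^ 2 ∂μ ≤ X j j := by
    intro j t ht
    simp_rw [pow_two]
    rw [h.integral_linearResponse_mul_linearResponse hX ht, exp_smul_transpose, Matrix.sub_apply]
    have := (hXp.mul_mul_conjTranspose_same (NormedSpace.exp (t • M))).diag_nonneg (i := j)
    simp only [Matrix.conjTranspose_eq_transpose_of_trivial] at this
    linarith
  have h1 := tendsto_integral_decay (μ := μ) hM hz₀
    (Y := fun t ω => linearResponse M 0 (η ω) t i) (fun t ht => hζ t ht i) (hζ2 i) k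
  have h2 := tendsto_integral_decay (μ := μ) hM hz₀
    (Y := fun t ω => linearResponse M 0 (η ω) t k) (fun t ht => hζ t ht k) (hζ2 k) i
  have h3 : Tendsto (fun t : ℝ => ∫ ω, (NormedSpace.exp (t • M) *ᵥ z₀ ω) k *
      (NormedSpace.exp (t • M) *ᵥ z₀ ω) i ∂μ) atTop (𝓝 0) := by
    have h4 : ∀ l, Tendsto (fun t : ℝ => NormedSpace.exp (t • M) i l *
        ∫ ω, (NormedSpace.exp (t • M) *ᵥ z₀ ω) k * z₀ ω l ∂μ) atTop (𝓝 0) := by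
      intro l
      have h5 : Tendsto (fun t : ℝ => NormedSpace.exp (t • M) i l) atTop (𝓝 0) :=
        tendsto_pi_nhds.1 (tendsto_pi_nhds.1 hM.tendsto_exp i) l
      simpa using h5.mul (tendsto_integral_decay (μ := μ) hM hz₀ (Y := fun _ ω => z₀ ω l)
        (fun t _ => hz₀ l) (fun _ _ => le_rfl) k)
    have h6 := tendsto_finsetSum Finset.univ fun l _ => h4 l
    rw [Finset.sum_const_zero] at h6
    refine h6.congr fun t => ?_
    simp_rw [← integral_const_mul]
    rw [← integral_finsetSum _ fun l _ =>
      (integrable_mul_of_memLp_two (hy t k) (hz₀ l)).const_mul _]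
    refine integral_congr_ae (ae_of_all _ fun ω => ?_)
    change _ = _ * ∑ l, _
    rw [Finset.mul_sum]
    exact Finset.sum_congr rfl fun l _ => by ring
  have h4 : Tendsto (fun t : ℝ => (X - NormedSpace.exp (t • M) * X * NormedSpace.exp (t • Mᵀ)) i k)
      atTop (𝓝 (X i k)) := by
    have h5 : Tendsto (fun t : ℝ => (NormedSpace.exp (t • M) * X * NormedSpace.exp (t • Mᵀ)) i k)
        atTop (𝓝 0) :=
      tendsto_pi_nhds.1 (tendsto_pi_nhds.1 (hM.tendsto_exp_mul_mul_exp hM.transpose X) i) k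
    simpa using h5.const_sub (X i k)
  have h5 := ((h3.add h1).add h2).add h4
  simp only [zero_add] at h5
  refine h5.congr' ?_
  filter_upwards [eventually_ge_atTop 0] with t ht
  have hi1 := integrable_mul_of_memLp_two (hy t k) (hy t i)
  have hi2 := integrable_mul_of_memLp_two (hy t k) (hζ t ht i)
  have hi3 := integrable_mul_of_memLp_two (hy t i) (hζ t ht k)
  have hi4 := integrable_mul_of_memLp_two (hζ t ht k) (hζ t ht i)
  rw [← h.integral_linearResponse_mul_linearResponse hX ht, ← integral_add' hi1 hi2,
    ← integral_add' (hi1.add hi2) hi3, ← integral_add' ((hi1.add hi2).add hi3) hi4]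
  refine integral_congr_ae (ae_of_all _ fun ω => ?_)
  simp only [linearResponse_eq_add M (z₀ ω) (η ω) t, Pi.add_apply]
  ring

end StationaryCovariance

/-! ### The cost as a trace against the stationary covariance -/

section Cost

variable {n m p : ℕ} {Ω : Type*} [MeasurableSpace Ω] {μ : Measure Ω} [IsProbabilityMeasure μ]

/-- The weight `diag(Q, C_Kᵀ R C_K)` of the stage cost as a quadratic form in the closed-loop
state. -/
noncomputable def Problem.stateWeight (S : Problem n m p) (K : Controller n m p) :
    Matrix (Fin n ⊕ Fin n) (Fin n ⊕ Fin n) ℝ :=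
  Matrix.fromBlocks S.Q 0 0 ((Controller.CK K)ᵀ * S.R * Controller.CK K)

/-- The stationary covariance of the closed-loop state. -/
noncomputable def Problem.stationaryCov (S : Problem n m p) (K : Controller n m p) :
    Matrix (Fin n ⊕ Fin n) (Fin n ⊕ Fin n) ℝ :=
  lyapunovSol (S.closedLoop K) (S.noiseIntensity K)

/-- The stationary cost `tr(Q̃ X)`. -/
noncomputable def Problem.stationaryCost (S : Problem n m p) (K : Controller n m p) : ℝ :=
  (S.stateWeight K * S.stationaryCov K).trace

theorem Problem.stageCost_eq (S : Problem n m p) (K : Controller n m p)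
    (z : Fin n ⊕ Fin n → ℝ) :
    S.stageCost K z = ∑ i, ∑ j, S.stateWeight K i j * (z i * z j) := by
  have h : S.stageCost K z = z ⬝ᵥ (S.stateWeight K *ᵥ z) := by
    simp only [Problem.stageCost, Problem.stateWeight, Matrix.fromBlocks_mulVec,
      Matrix.zero_mulVec, add_zero, zero_add]
    simp only [dotProduct, Fintype.sum_sum_type, Sum.elim_inl, Sum.elim_inr]
    congr 1
    change (Controller.CK K *ᵥ (z ∘ Sum.inr)) ⬝ᵥ (S.R *ᵥ (Controller.CK K *ᵥ (z ∘ Sum.inr)))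
      = (z ∘ Sum.inr) ⬝ᵥ _
    rw [← Matrix.mulVec_mulVec, ← Matrix.mulVec_mulVec, Matrix.dotProduct_mulVec (z ∘ Sum.inr),
      Matrix.vecMul_transpose]
  rw [h]
  simp only [dotProduct, Matrix.mulVec, Finset.mul_sum]
  exact Finset.sum_congr rfl fun i _ => Finset.sum_congr rfl fun j _ => by ring

theorem Problem.noiseIntensity_posSemidef (S : Problem n m p) (hW : S.W.PosSemidef)
    (hV : S.V.PosSemidef) (K : Controller n m p) : (S.noiseIntensity K).PosSemidef := by
  refine Matrix.PosSemidef.of_dotProduct_mulVec_nonneg ?_ fun z => ?_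
  · have h2 : (S.noiseIntensity K)ᵀ = S.noiseIntensity K := by
      have hWt : S.Wᵀ = S.W := by simpa using hW.isHermitian.eq
      have hVt : S.Vᵀ = S.V := by simpa using hV.isHermitian.eq
      simp [Problem.noiseIntensity, Matrix.fromBlocks_transpose, hWt, hVt, Matrix.mul_assoc]
    simpa [Matrix.IsHermitian] using h2
  · have h1 := hW.dotProduct_mulVec_nonneg (z ∘ Sum.inl)
    have h2 := (hV.mul_mul_conjTranspose_same (Controller.BK K)).dotProduct_mulVec_nonneg
      (z ∘ Sum.inr)
    simp only [star_trivial, Matrix.conjTranspose_eq_transpose_of_trivial] at h1 h2 ⊢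
    rw [Problem.noiseIntensity, Matrix.fromBlocks_mulVec]
    simp only [Matrix.zero_mulVec, add_zero, zero_add]
    simp only [dotProduct, Fintype.sum_sum_type, Sum.elim_inl, Sum.elim_inr] at h1 h2 ⊢
    exact add_nonneg h1 h2

/-- The stage cost is a finite combination of products of state coordinates. Fubini reduces the
expected cost to time integrals of second moments, which converge and hence converge on average. -/
theorem Problem.cost_spec (S : Problem n m p) (hS : S.IsMinimal)
    {w : ℝ≥0 → Ω → EuclideanSpace ℝ (Fin n)} {v : ℝ≥0 → Ω → EuclideanSpace ℝ (Fin p)}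
    (hw : IsBrownianWithIntensity w S.W μ) (hv : IsBrownianWithIntensity v S.V μ)
    (hwv : IndepFun (fun ω t => w t ω) (fun ω t => v t ω) μ)
    {x₀ ξ₀ : Ω → Fin n → ℝ} (hx₀ : MemLp x₀ 2 μ) (hξ₀ : MemLp ξ₀ 2 μ)
    {K : Controller n m p} (hK : K ∈ S.stabilizing) :
    (∀ T : ℝ, 0 < T → Integrable (S.pathCost w v x₀ ξ₀ K T) μ) ∧
      Tendsto (S.averageCost μ w v x₀ ξ₀ K) atTop (𝓝 (S.stationaryCost K)) := by
  have hM : IsStable (S.closedLoop K) := hK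
  have hN := S.isNoise_closedLoopNoise hS.W_psd hS.V_pd.posSemidef hw hv hwv K
  have hz₀ : ∀ i, MemLp (fun ω => (Sum.elim (x₀ ω) (ξ₀ ω) : Fin n ⊕ Fin n → ℝ) i) 2 μ := by
    rintro (i | i)
    · exact hx₀.continuousLinearMap_comp (ContinuousLinearMap.proj (R := ℝ) i)
    · exact hξ₀.continuousLinearMap_comp (ContinuousLinearMap.proj (R := ℝ) i)
  let z : ℝ → Ω → Fin n ⊕ Fin n → ℝ := fun t ω =>
    linearResponse (S.closedLoop K) (Sum.elim (x₀ ω) (ξ₀ ω)) (closedLoopNoise w v K ω) t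
  have hp : ∀ i, IsSquareIntegrablePath (fun t ω => z t ω i) μ :=
    fun i => hN.isSquareIntegrablePath_linearResponse hM hz₀ i
  -- The integrability of the products along a path is taken from Fubini, hence the restriction to
  -- almost every `ω`, which is harmless under the expectation.
  have hpath : ∀ T, 0 ≤ T → ∀ᵐ ω ∂μ, S.pathCost w v x₀ ξ₀ K T ω = ∑ i, ∑ j,
      S.stateWeight K i j * ∫ t in (0 : ℝ)..T, z t ω i * z t ω j := by
    intro T hT
    have h1 : ∀ᵐ ω ∂μ, ∀ i j, IntervalIntegrable (fun t => z t ω i * z t ω j) volume 0 T := by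
      rw [ae_all_iff]
      intro i
      rw [ae_all_iff]
      intro j
      exact (hp i).ae_intervalIntegrable_mul (hp j) hT
    filter_upwards [h1] with ω hω
    simp only [Problem.pathCost, Problem.stageCost_eq]
    change ∫ t in (0 : ℝ)..T, ∑ i, ∑ j, S.stateWeight K i j * (z t ω i * z t ω j) = _
    have h2 : ∀ i, IntervalIntegrable
        (fun t => ∑ j, S.stateWeight K i j * (z t ω i * z t ω j)) volume 0 T := fun i => by
      simpa only [Finset.sum_fn] using IntervalIntegrable.sum Finset.univ
        fun j _ => (hω i j).const_mul (S.stateWeight K i j)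
    rw [intervalIntegral.integral_finsetSum fun i _ => h2 i]
    refine Finset.sum_congr rfl fun i _ => ?_
    rw [intervalIntegral.integral_finsetSum fun j _ => (hω i j).const_mul _]
    exact Finset.sum_congr rfl fun j _ => intervalIntegral.integral_const_mul _ _
  have hint : ∀ T, 0 ≤ T → ∀ i j, Integrable (fun ω =>
      S.stateWeight K i j * ∫ t in (0 : ℝ)..T, z t ω i * z t ω j) μ := fun T hT i j =>
    ((hp i).integral_mul (hp j) hT).1.const_mul _
  refine ⟨fun T hT => (integrable_finsetSum _ fun i _ => integrable_finsetSum _ fun j _ =>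
    hint T hT.le i j).congr ((hpath T hT.le).mono fun ω h => h.symm), ?_⟩
  have havg : ∀ T, 0 ≤ T → S.averageCost μ w v x₀ ξ₀ K T = ∑ i, ∑ j,
      S.stateWeight K i j * (1 / T * ∫ t in (0 : ℝ)..T, ∫ ω, z t ω i * z t ω j ∂μ) := by
    intro T hT
    rw [Problem.averageCost, integral_congr_ae (hpath T hT),
      integral_finsetSum _ fun i _ => integrable_finsetSum _ fun j _ => hint T hT i j,
      Finset.mul_sum]
    refine Finset.sum_congr rfl fun i _ => ?_
    rw [integral_finsetSum _ fun j _ => hint T hT i j, Finset.mul_sum]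
    refine Finset.sum_congr rfl fun j _ => ?_
    rw [integral_const_mul, ((hp i).integral_mul (hp j) hT).2.2]
    ring
  have hlim : Tendsto (fun T : ℝ => ∑ i, ∑ j,
      S.stateWeight K i j * (1 / T * ∫ t in (0 : ℝ)..T, ∫ ω, z t ω i * z t ω j ∂μ)) atTop
      (𝓝 (∑ i, ∑ j, S.stateWeight K i j * S.stationaryCov K j i)) :=
    tendsto_finsetSum _ fun i _ => tendsto_finsetSum _ fun j _ =>
      (tendsto_average (fun T hT => ((hp i).integral_mul (hp j) hT).2.1)
        (hN.tendsto_integral_mul hM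
          (S.noiseIntensity_posSemidef hS.W_psd hS.V_pd.posSemidef K) hz₀ j i)).const_mul _
  have htr : S.stationaryCost K = ∑ i, ∑ j, S.stateWeight K i j * S.stationaryCov K j i := rfl
  rw [htr]
  refine hlim.congr' ?_
  filter_upwards [eventually_ge_atTop 0] with T hT
  exact (havg T hT).symm

end Cost

/-! ### Rank conditions as kernel conditions -/

section Observability

/-- Rank–nullity for the observability matrix: full column rank leaves no kernel. -/
theorem Observable.eq_zero {n k : ℕ} {C : Matrix (Fin k) (Fin n) ℝ} {A : Matrix (Fin n) (Fin n) ℝ}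
    (h : Observable C A) {v : Fin n → ℝ} (hv : ∀ l : ℕ, C *ᵥ ((A ^ l) *ᵥ v) = 0) : v = 0 := by
  set O : Matrix (Fin n × Fin k) (Fin n) ℝ :=
    Matrix.of fun (lj : Fin n × Fin k) (i : Fin n) => (C * A ^ (lj.1 : ℕ)) lj.2 i with hO
  have h1 : O.rank = n := h
  have h2 := LinearMap.finrank_range_add_finrank_ker O.mulVecLin
  rw [Matrix.rank] at h1
  rw [h1, Module.finrank_fin_fun, Nat.add_eq_left, Submodule.finrank_eq_zero] at h2
  have h3 : v ∈ LinearMap.ker O.mulVecLin := by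
    rw [LinearMap.mem_ker, Matrix.mulVecLin_apply]
    ext lj
    have := congrFun (hv lj.1) lj.2
    rw [Matrix.mulVec_mulVec] at this
    exact this
  rw [h2] at h3
  exact (Submodule.mem_bot ℝ).1 h3

theorem Controllable.transpose {n k : ℕ} {A : Matrix (Fin n) (Fin n) ℝ}
    {B : Matrix (Fin n) (Fin k) ℝ} (h : Controllable A B) : Observable Bᵀ Aᵀ := by
  rw [Controllable, ← Matrix.rank_transpose] at h
  refine (congrArg Matrix.rank ?_).trans h
  ext lj i
  simp only [Matrix.of_apply, Matrix.transpose_apply, ← Matrix.transpose_pow,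
    ← Matrix.transpose_mul]

theorem Observable.transpose {n k : ℕ} {A : Matrix (Fin n) (Fin n) ℝ}
    {C : Matrix (Fin k) (Fin n) ℝ} (h : Observable C A) : Controllable Aᵀ Cᵀ := by
  rw [Observable, ← Matrix.rank_transpose] at h
  refine (congrArg Matrix.rank ?_).trans h
  ext i lj
  simp only [Matrix.of_apply, Matrix.transpose_apply, ← Matrix.transpose_pow,
    ← Matrix.transpose_mul]

theorem sqrt_mulVec_eq_zero {ι : Type*} [Fintype ι] [DecidableEq ι] {W : Matrix ι ι ℝ}
    (hW : W.PosSemidef) {v : ι → ℝ} (hv : W *ᵥ v = 0) : CFC.sqrt W *ᵥ v = 0 := by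
  have h1 : (CFC.sqrt W)ᵀ = CFC.sqrt W := by
    simpa using (Matrix.nonneg_iff_posSemidef.1 (CFC.sqrt_nonneg W)).isHermitian.eq
  have h2 : CFC.sqrt W * CFC.sqrt W = W := CFC.sqrt_mul_sqrt_self W hW.nonneg
  rw [← dotProduct_self_eq_zero, Matrix.dotProduct_mulVec, ← Matrix.mulVec_transpose, h1,
    Matrix.mulVec_mulVec, h2, hv, zero_dotProduct]

theorem transpose_sqrt {ι : Type*} [Fintype ι] [DecidableEq ι] (W : Matrix ι ι ℝ) :
    (CFC.sqrt W)ᵀ = CFC.sqrt W := by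
  simpa using (Matrix.nonneg_iff_posSemidef.1 (CFC.sqrt_nonneg W)).isHermitian.eq

theorem mulVec_transpose_eq_zero_of_mul_mul {ι κ : Type*} [Fintype ι] [Fintype κ]
    {V : Matrix κ κ ℝ} (hV : V.PosDef) {B : Matrix ι κ ℝ} {v : ι → ℝ}
    (hv : (B * V * Bᵀ) *ᵥ v = 0) : Bᵀ *ᵥ v = 0 := by
  have h1 : v ⬝ᵥ ((B * V * Bᵀ) *ᵥ v) = (Bᵀ *ᵥ v) ⬝ᵥ (V *ᵥ (Bᵀ *ᵥ v)) := by
    rw [← Matrix.mulVec_mulVec, ← Matrix.mulVec_mulVec, Matrix.dotProduct_mulVec v B,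
      ← Matrix.mulVec_transpose]
  by_contra h0
  have h2 := hV.dotProduct_mulVec_pos h0
  rw [star_trivial, ← h1, hv, dotProduct_zero] at h2
  exact lt_irrefl _ h2

/-- By cyclicity the trace is that of `√Z R √Z`, which is positive semidefinite. -/
theorem _root_.Matrix.PosSemidef.trace_mul_nonneg {ι : Type*} [Fintype ι] [DecidableEq ι]
    {R Z : Matrix ι ι ℝ} (hR : R.PosSemidef) (hZ : Z.PosSemidef) : 0 ≤ (R * Z).trace := by
  have h2 : CFC.sqrt Z * CFC.sqrt Z = Z := CFC.sqrt_mul_sqrt_self Z hZ.nonneg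
  have h3 := (hR.mul_mul_conjTranspose_same (CFC.sqrt Z)).trace_nonneg
  rw [Matrix.conjTranspose_eq_transpose_of_trivial, transpose_sqrt] at h3
  rwa [← h2, ← mul_assoc, Matrix.trace_mul_comm, ← mul_assoc]

end Observability

/-! ### Duality of control and filtering, and definiteness from minimality -/

section Duality

variable {n m p : ℕ}

/-- The dual problem exchanges control and filtering. -/
noncomputable def Problem.dual (S : Problem n m p) : Problem n p m where
  A := S.Aᵀ
  B := S.Cᵀ
  C := S.Bᵀ
  Q := S.W
  R := S.V
  W := S.Q
  V := S.R

/-- The dual controller. -/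
def Controller.dual (K : Controller n m p) : Controller n p m :=
  (K.1ᵀ, K.2.2ᵀ, K.2.1ᵀ)

theorem Problem.IsMinimal.dual {S : Problem n m p} (h : S.IsMinimal) : S.dual.IsMinimal where
  Q_psd := h.W_psd
  R_pd := h.V_pd
  W_psd := h.Q_psd
  V_pd := h.R_pd
  controllable_AB := h.observable_CA.transpose
  controllable_AW := by
    have := h.observable_QA.transpose
    rwa [transpose_sqrt] at this
  observable_CA := h.controllable_AB.transpose
  observable_QA := by
    have := h.controllable_AW.transpose
    rwa [transpose_sqrt] at this

theorem Controller.IsMinimal.dual {K : Controller n m p} (h : Controller.IsMinimal K) :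
    Controller.IsMinimal (Controller.dual K) :=
  ⟨h.2.transpose, h.1.transpose⟩

theorem Problem.dual_closedLoop (S : Problem n m p) (K : Controller n m p) :
    S.dual.closedLoop (Controller.dual K) = (S.closedLoop K)ᵀ := by
  simp [Problem.closedLoop, Problem.dual, Controller.dual, Matrix.fromBlocks_transpose,
    Controller.AK, Controller.BK, Controller.CK]

theorem Problem.dual_noiseIntensity (S : Problem n m p) (K : Controller n m p) :
    S.dual.noiseIntensity (Controller.dual K) = S.stateWeight K := by
  simp [Problem.noiseIntensity, Problem.stateWeight, Problem.dual, Controller.dual,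
    Controller.BK, Controller.CK]

theorem Problem.dual_mem_stabilizing {S : Problem n m p} {K : Controller n m p}
    (hK : K ∈ S.stabilizing) : Controller.dual K ∈ S.dual.stabilizing := by
  change IsStable _
  rw [S.dual_closedLoop]
  exact IsStable.transpose hK

theorem Problem.stationaryCov_spec (S : Problem n m p) {K : Controller n m p}
    (hK : K ∈ S.stabilizing) : S.closedLoop K * S.stationaryCov K
      + S.stationaryCov K * (S.closedLoop K)ᵀ + S.noiseIntensity K = 0 :=
  IsStable.lyapunovSol_spec hK _

/-- The stationary covariance of the dual closed loop solves the adjoint Lyapunov equation. -/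
theorem Problem.dual_stationaryCov_spec (S : Problem n m p) {K : Controller n m p}
    (hK : K ∈ S.stabilizing) : (S.closedLoop K)ᵀ * S.dual.stationaryCov (Controller.dual K)
      + S.dual.stationaryCov (Controller.dual K) * S.closedLoop K + S.stateWeight K = 0 := by
  have := S.dual.stationaryCov_spec (Problem.dual_mem_stabilizing hK)
  rwa [S.dual_closedLoop, S.dual_noiseIntensity, Matrix.transpose_transpose] at this

theorem Problem.IsMinimal.stationaryCov_posSemidef {S : Problem n m p} (hS : S.IsMinimal)
    {K : Controller n m p} (hK : K ∈ S.stabilizing) : (S.stationaryCov K).PosSemidef :=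
  IsStable.posSemidef_of_lyapunov hK
    (S.noiseIntensity_posSemidef hS.W_psd hS.V_pd.posSemidef K) (S.stationaryCov_spec hK)

/-- Follow a kernel vector `(a, b)` under the transposed closed loop. The noise kernel forces `W a =
0` and `B_Kᵀ b = 0` along the orbit; the latter decouples `a`, which then moves by `Aᵀ` and is zero
by controllability of `(A, W^{1/2})`. With `a = 0`, `b` moves by `A_Kᵀ` and is zero by
controllability of the controller. -/
theorem Problem.IsMinimal.stationaryCov_posDef {S : Problem n m p} (hS : S.IsMinimal)
    {K : Controller n m p} (hK : K ∈ S.stabilizing) (hKc : Controllable K.AK K.BK) :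
    (S.stationaryCov K).PosDef := by
  refine IsStable.posDef_of_lyapunov hK
    (S.noiseIntensity_posSemidef hS.W_psd hS.V_pd.posSemidef K) (S.stationaryCov_spec hK)
    fun v hv => ?_
  set z : ℕ → Fin n ⊕ Fin n → ℝ := fun k => ((S.closedLoop K)ᵀ ^ k) *ᵥ v with hz
  have hz1 : ∀ k, z (k + 1) = (S.closedLoop K)ᵀ *ᵥ z k := fun k => by
    simp only [hz, Matrix.mulVec_mulVec, pow_succ']
  have hn : ∀ k, S.W *ᵥ (z k ∘ Sum.inl) = 0 ∧ K.BKᵀ *ᵥ (z k ∘ Sum.inr) = 0 := by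
    intro k
    have h1 : S.noiseIntensity K *ᵥ z k = 0 := hv k
    rw [Problem.noiseIntensity, Matrix.fromBlocks_mulVec] at h1
    simp only [Matrix.zero_mulVec, add_zero, zero_add] at h1
    exact ⟨funext fun i => congrFun h1 (Sum.inl i),
      mulVec_transpose_eq_zero_of_mul_mul hS.V_pd (funext fun i => congrFun h1 (Sum.inr i))⟩
  have hinl : ∀ k, z (k + 1) ∘ Sum.inl = S.Aᵀ *ᵥ (z k ∘ Sum.inl) := by
    intro k
    rw [hz1, Problem.closedLoop, Matrix.fromBlocks_transpose, Matrix.fromBlocks_mulVec,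
      Matrix.transpose_mul, ← Matrix.mulVec_mulVec, (hn k).2]
    ext i
    simp
  have hinl2 : ∀ k, z k ∘ Sum.inl = (S.Aᵀ ^ k) *ᵥ (v ∘ Sum.inl) := by
    intro k
    induction k with
    | zero => simp [hz]
    | succ k ih => rw [hinl, ih, Matrix.mulVec_mulVec, ← pow_succ']
  have hobs := hS.controllable_AW.transpose
  rw [transpose_sqrt] at hobs
  have ha : v ∘ Sum.inl = 0 := hobs.eq_zero fun k => by
    rw [← hinl2]
    exact sqrt_mulVec_eq_zero hS.W_psd (hn k).1
  have ha2 : ∀ k, z k ∘ Sum.inl = 0 := fun k => by rw [hinl2, ha, Matrix.mulVec_zero]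
  have hinr : ∀ k, z (k + 1) ∘ Sum.inr = K.AKᵀ *ᵥ (z k ∘ Sum.inr) := by
    intro k
    rw [hz1, Problem.closedLoop, Matrix.fromBlocks_transpose, Matrix.fromBlocks_mulVec, ha2]
    ext i
    simp
  have hinr2 : ∀ k, z k ∘ Sum.inr = (K.AKᵀ ^ k) *ᵥ (v ∘ Sum.inr) := by
    intro k
    induction k with
    | zero => simp [hz]
    | succ k ih => rw [hinr, ih, Matrix.mulVec_mulVec, ← pow_succ']
  have hb : v ∘ Sum.inr = 0 := hKc.transpose.eq_zero fun k => by
    rw [← hinr2]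
    exact (hn k).2
  ext (i | i)
  · exact congrFun ha i
  · exact congrFun hb i

end Duality

/-! ### Schur complements and uniqueness for the Riccati equation -/

section Riccati

variable {n m p : ℕ}

/-- With `X₁₂ = -F X₂₂`, the best linear estimate of `x` from `ξ` is `-F ξ`. The right-hand side, a
Schur complement, is the covariance of the estimation error `x + F ξ`. -/
theorem fromCols_one_mul_fromBlocks_mul (F X₁₁ X₂₂ : Matrix (Fin n) (Fin n) ℝ)
    (hX : X₂₂ᵀ = X₂₂) :
    Matrix.fromCols (1 : Matrix (Fin n) (Fin n) ℝ) F *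
      Matrix.fromBlocks X₁₁ (-(F * X₂₂)) (-(F * X₂₂))ᵀ X₂₂ *
      (Matrix.fromCols (1 : Matrix (Fin n) (Fin n) ℝ) F)ᵀ = X₁₁ - F * X₂₂ * Fᵀ := by
  rw [Matrix.fromCols_mul_fromBlocks, Matrix.transpose_fromCols, Matrix.fromCols_mul_fromRows]
  simp [hX, ← sub_eq_add_neg, Matrix.mul_assoc]

theorem posDef_schur {F X₁₁ X₂₂ : Matrix (Fin n) (Fin n) ℝ} (hX : X₂₂ᵀ = X₂₂)
    (h : (Matrix.fromBlocks X₁₁ (-(F * X₂₂)) (-(F * X₂₂))ᵀ X₂₂).PosDef) :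
    (X₁₁ - F * X₂₂ * Fᵀ).PosDef := by
  rw [← fromCols_one_mul_fromBlocks_mul F X₁₁ X₂₂ hX]
  refine h.mul_mul_conjTranspose_same fun v v' hv => ?_
  ext i
  have := congrFun hv (Sum.inl i)
  simpa [Matrix.vecMul_fromCols] using this

/-- The filter Riccati equation has at most one positive definite solution. -/
theorem Problem.IsMinimal.filterRiccati_unique {S : Problem n m p} (hS : S.IsMinimal)
    {P P' : Matrix (Fin n) (Fin n) ℝ} (hP : P.PosDef) (hP' : P'.PosDef)
    (h : S.A * P + P * S.Aᵀ - P * S.Cᵀ * S.V⁻¹ * S.C * P + S.W = 0)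
    (h' : S.A * P' + P' * S.Aᵀ - P' * S.Cᵀ * S.V⁻¹ * S.C * P' + S.W = 0) : P' = P := by
  have hVt : S.Vᵀ = S.V := by simpa using hS.V_pd.1.eq
  have hVit : S.V⁻¹ᵀ = S.V⁻¹ := by rw [Matrix.transpose_nonsing_inv, hVt]
  have hVi : S.V⁻¹ * S.V = 1 :=
    Matrix.nonsing_inv_mul _ ((Matrix.isUnit_iff_isUnit_det _).1 hS.V_pd.isUnit)
  have hobs := hS.controllable_AW.transpose
  rw [transpose_sqrt] at hobs
  -- Every positive definite solution is stabilizing. With `L = X Cᵀ V⁻¹` the Riccati equation is a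
  -- Lyapunov equation for `A - L C` with inhomogeneity `W + L V Lᵀ`. On an invariant plane in its
  -- kernel `Lᵀ` vanishes, so the plane is `Aᵀ`-invariant and annihilated by `W`, against
  -- controllability.
  have key : ∀ {X : Matrix (Fin n) (Fin n) ℝ}, X.PosDef →
      S.A * X + X * S.Aᵀ - X * S.Cᵀ * S.V⁻¹ * S.C * X + S.W = 0 →
      IsStable (S.A - X * S.Cᵀ * S.V⁻¹ * S.C) := by
    intro X hX hR
    have hXt : Xᵀ = X := by simpa using hX.1.eq
    set L := X * S.Cᵀ * S.V⁻¹ with hL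
    have hLt : Lᵀ = S.V⁻¹ * S.C * X := by
      simp [hL, Matrix.transpose_mul, hXt, hVit, Matrix.mul_assoc]
    have hLV : L * S.V = X * S.Cᵀ := by rw [hL, Matrix.mul_assoc, hVi, Matrix.mul_one]
    have hLVL : (L * S.V * Lᵀ).PosSemidef := by
      simpa using hS.V_pd.posSemidef.mul_mul_conjTranspose_same L
    refine isStable_of_lyapunov (H := S.W + L * S.V * Lᵀ) hX (hS.W_psd.add hLVL) ?_ ?_
    · have h1 : X * (L * S.C)ᵀ = L * S.C * X := by
        rw [Matrix.transpose_mul, hLt, hL]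
        simp only [Matrix.mul_assoc]
      have h2 : L * S.V * Lᵀ = L * S.C * X := by
        rw [hLV, hLt, hL]
        simp only [Matrix.mul_assoc]
      rw [Matrix.transpose_sub, Matrix.sub_mul, Matrix.mul_sub, h1, h2, ← hR]
      abel
    · intro σ ω a b ha hb hHa hHb
      have hsplit : ∀ c : Fin n → ℝ, (S.W + L * S.V * Lᵀ) *ᵥ c = 0 →
          S.W *ᵥ c = 0 ∧ Lᵀ *ᵥ c = 0 := by
        intro c hc
        have h1 := hS.W_psd.dotProduct_mulVec_nonneg c
        have h2 := hLVL.dotProduct_mulVec_nonneg c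
        have h3 : c ⬝ᵥ (S.W *ᵥ c) + c ⬝ᵥ ((L * S.V * Lᵀ) *ᵥ c) = 0 := by
          rw [← dotProduct_add, ← Matrix.add_mulVec, hc, dotProduct_zero]
        simp only [star_trivial] at h1 h2
        exact ⟨(hS.W_psd.dotProduct_mulVec_zero_iff c).1 (by rw [star_trivial]; linarith),
          mulVec_transpose_eq_zero_of_mul_mul hS.V_pd
            ((hLVL.dotProduct_mulVec_zero_iff c).1 (by rw [star_trivial]; linarith))⟩
      obtain ⟨hWa, hLa⟩ := hsplit a hHa
      obtain ⟨hWb, hLb⟩ := hsplit b hHb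
      have hA : ∀ c : Fin n → ℝ, Lᵀ *ᵥ c = 0 → (S.A - L * S.C)ᵀ *ᵥ c = S.Aᵀ *ᵥ c := by
        intro c hc
        rw [Matrix.transpose_sub, Matrix.sub_mulVec, Matrix.transpose_mul, ← Matrix.mulVec_mulVec,
          hc, Matrix.mulVec_zero, sub_zero]
      rw [hA a hLa] at ha
      rw [hA b hLb] at hb
      have hk : ∀ k : ℕ, S.W *ᵥ ((S.Aᵀ ^ k) *ᵥ a) = 0 ∧ S.W *ᵥ ((S.Aᵀ ^ k) *ᵥ b) = 0 := by
        intro k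
        induction k with
        | zero => simpa using ⟨hWa, hWb⟩
        | succ k ih =>
          simp only [pow_succ, ← Matrix.mulVec_mulVec, ha, hb, Matrix.mulVec_sub,
            Matrix.mulVec_add, Matrix.mulVec_smul, ih.1, ih.2]
          simp
      exact ⟨hobs.eq_zero fun k => sqrt_mulVec_eq_zero hS.W_psd (hk k).1,
        hobs.eq_zero fun k => sqrt_mulVec_eq_zero hS.W_psd (hk k).2⟩
  have hPt' : P'ᵀ = P' := by simpa using hP'.1.eq
  rw [← sub_eq_zero]
  -- The difference of two Riccati equations is linear: with `D = P' - P` it reads `(A - L C) D + D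
  -- (A - L' C)ᵀ = 0`.
  refine (key hP h).sylvester_unique (key hP' h').transpose ?_
  rw [Matrix.transpose_sub]
  simp only [Matrix.transpose_mul, Matrix.transpose_transpose, hVit, hPt', Matrix.mul_sub,
    Matrix.sub_mul]
  simp only [Matrix.mul_assoc] at h h' ⊢
  linear_combination (norm := abel) h' - h

end Riccati

/-! ### The derivative of the cost and the stationarity equations -/

section Gradient

theorem fromBlocks_sub_fromBlocks {ι κ : Type*} (A A' : Matrix ι ι ℝ) (B B' : Matrix ι κ ℝ)
    (C C' : Matrix κ ι ℝ) (D D' : Matrix κ κ ℝ) :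
    Matrix.fromBlocks A B C D - Matrix.fromBlocks A' B' C' D'
      = Matrix.fromBlocks (A - A') (B - B') (C - C') (D - D') := by
  ext (i | i) (j | j) <;> rfl

theorem trace_fromBlocks' {ι κ : Type*} [Fintype ι] [Fintype κ] (A : Matrix ι ι ℝ)
    (B : Matrix ι κ ℝ) (C : Matrix κ ι ℝ) (D : Matrix κ κ ℝ) :
    (Matrix.fromBlocks A B C D).trace = A.trace + D.trace := by
  simp [Matrix.trace]

/-- Eliminate `Q` by the adjoint equation at the base point and `M X' + X' Mᵀ` by the perturbed
Lyapunov equation. The identity is exact because `X'` is kept at the perturbed point, so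
differentiating it requires only continuity of the covariance. -/
theorem trace_lyapunov_sub {ι : Type*} [Fintype ι] {M M' Q Q' W W' X X' Y : Matrix ι ι ℝ}
    (hX : M * X + X * Mᵀ + W = 0) (hX' : M' * X' + X' * M'ᵀ + W' = 0)
    (hY : Mᵀ * Y + Y * M + Q = 0) (hXt : X'ᵀ = X') (hYt : Yᵀ = Y) :
    (Q' * X').trace - (Q * X).trace
      = ((Q' - Q) * X').trace + (Y * (W' - W)).trace + 2 * ((M' - M) * X' * Y).trace := by
  have h1 : (Q * X').trace - (Q * X).trace
      = -(Y * (M * X' + X' * Mᵀ)).trace + (Y * (M * X + X * Mᵀ)).trace := by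
    have hQ : Q = -(Mᵀ * Y + Y * M) := (neg_eq_of_add_eq_zero_right hY).symm
    have hc : ∀ Z : Matrix ι ι ℝ, (Mᵀ * (Y * Z)).trace = (Y * (Z * Mᵀ)).trace := fun Z => by
      rw [Matrix.trace_mul_comm, Matrix.mul_assoc]
    rw [hQ]
    simp only [Matrix.neg_mul, Matrix.add_mul, Matrix.mul_add, Matrix.trace_neg, Matrix.trace_add,
      Matrix.mul_assoc, hc]
    ring
  have h2 : M * X + X * Mᵀ = -W := eq_neg_of_add_eq_zero_left hX
  have h3 : M * X' + X' * Mᵀ = -W' - (M' - M) * X' - X' * (M' - M)ᵀ := by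
    rw [Matrix.sub_mul, Matrix.transpose_sub, Matrix.mul_sub]
    linear_combination (norm := abel) hX'
  have h4 : (Y * (X' * (M' - M)ᵀ)).trace = ((M' - M) * X' * Y).trace := by
    rw [← Matrix.trace_transpose]
    simp only [Matrix.transpose_mul, Matrix.transpose_transpose, hXt, hYt]
  have h5 : (Y * ((M' - M) * X')).trace = ((M' - M) * X' * Y).trace := Matrix.trace_mul_comm _ _
  rw [h2, h3, Matrix.mul_sub, Matrix.mul_sub, Matrix.trace_sub, Matrix.trace_sub, h4, h5] at h1
  simp only [Matrix.mul_neg, Matrix.trace_neg] at h1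
  rw [Matrix.sub_mul, Matrix.trace_sub, Matrix.mul_sub Y W', Matrix.trace_sub]
  linarith

section LineDeriv

attribute [local instance] Matrix.normedAddCommGroup Matrix.normedSpace

theorem tendsto_slope_of_hasFDerivAt_zero {n m p : ℕ} {J : Controller n m p → ℝ}
    {K : Controller n m p} (h : HasFDerivAt J (0 : Controller n m p →L[ℝ] ℝ) K)
    (D : Controller n m p) :
    Tendsto (fun s : ℝ => s⁻¹ * (J (K + s • D) - J K)) (𝓝[≠] 0) (𝓝 0) := by
  have h1 : HasDerivAt (fun s : ℝ => K + s • D) D 0 := by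
    have h2 : HasDerivAt (fun s : ℝ => s • D) D 0 :=
      ((hasDerivAt_id (0 : ℝ)).smul_const D).congr_deriv (one_smul ℝ D)
    exact h2.const_add K
  have h0 : HasFDerivAt J (0 : Controller n m p →L[ℝ] ℝ) ((fun s : ℝ => K + s • D) 0) := by
    simpa using h
  have h2 := (h0.comp_hasDerivAt 0 h1).tendsto_slope_zero
  simp only [Function.comp_apply, zero_add, zero_smul, add_zero, smul_eq_mul] at h2
  exact h2

end LineDeriv

variable {n m p : ℕ}

theorem Problem.tendsto_closedLoop (S : Problem n m p) (K D : Controller n m p) :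
    Tendsto (fun s : ℝ => S.closedLoop (K + s • D)) (𝓝 0) (𝓝 (S.closedLoop K)) := by
  have h : Continuous fun s : ℝ => S.closedLoop (K + s • D) := by
    simp only [Problem.closedLoop, Controller.AK, Controller.BK, Controller.CK]
    refine Continuous.matrix_fromBlocks continuous_const ?_ ?_ ?_
    · exact continuous_const.matrix_mul (continuous_const.add (continuous_id.smul continuous_const))
    · exact (continuous_const.add (continuous_id.smul continuous_const)).matrix_mul continuous_const
    · exact continuous_const.add (continuous_id.smul continuous_const)
  simpa using h.tendsto 0

theorem Problem.tendsto_noiseIntensity (S : Problem n m p) (K D : Controller n m p) :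
    Tendsto (fun s : ℝ => S.noiseIntensity (K + s • D)) (𝓝 0) (𝓝 (S.noiseIntensity K)) := by
  have h : Continuous fun s : ℝ => S.noiseIntensity (K + s • D) := by
    simp only [Problem.noiseIntensity, Controller.BK]
    have h1 : Continuous fun s : ℝ => (K + s • D).2.1 :=
      continuous_const.add (continuous_id.smul continuous_const)
    exact Continuous.matrix_fromBlocks continuous_const continuous_const continuous_const
      ((h1.matrix_mul continuous_const).matrix_mul h1.matrix_transpose)
  simpa using h.tendsto 0

/-- The directional derivative of the stationary cost. -/
theorem Problem.IsMinimal.gradient_eq_zero {S : Problem n m p} (hS : S.IsMinimal)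
    {K : Controller n m p} (hK : K ∈ S.stabilizing) {J : Controller n m p → ℝ}
    (hJ : ∀ K' ∈ S.stabilizing, J K' = S.stationaryCost K')
    (h : HasFDerivAt J (0 : Controller n m p →L[ℝ] ℝ) K) (D : Controller n m p) :
    (Matrix.fromBlocks 0 0 0 (D.CKᵀ * S.R * K.CK + K.CKᵀ * S.R * D.CK) * S.stationaryCov K).trace
      + (S.dual.stationaryCov (Controller.dual K) *
          Matrix.fromBlocks 0 0 0 (D.BK * S.V * K.BKᵀ + K.BK * S.V * D.BKᵀ)).trace
      + 2 * (Matrix.fromBlocks 0 (S.B * D.CK) (D.BK * S.C) D.AK * S.stationaryCov K *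
          S.dual.stationaryCov (Controller.dual K)).trace = 0 := by
  set Y := S.dual.stationaryCov (Controller.dual K)
  set Q₁ : Matrix (Fin n ⊕ Fin n) (Fin n ⊕ Fin n) ℝ :=
    Matrix.fromBlocks 0 0 0 (D.CKᵀ * S.R * K.CK + K.CKᵀ * S.R * D.CK) with hQ₁
  set W₁ : Matrix (Fin n ⊕ Fin n) (Fin n ⊕ Fin n) ℝ :=
    Matrix.fromBlocks 0 0 0 (D.BK * S.V * K.BKᵀ + K.BK * S.V * D.BKᵀ) with hW₁
  set E : Matrix (Fin n ⊕ Fin n) (Fin n ⊕ Fin n) ℝ :=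
    Matrix.fromBlocks 0 (S.B * D.CK) (D.BK * S.C) D.AK with hE
  set Q₂ : Matrix (Fin n ⊕ Fin n) (Fin n ⊕ Fin n) ℝ :=
    Matrix.fromBlocks 0 0 0 (D.CKᵀ * S.R * D.CK) with hQ₂
  set W₂ : Matrix (Fin n ⊕ Fin n) (Fin n ⊕ Fin n) ℝ :=
    Matrix.fromBlocks 0 0 0 (D.BK * S.V * D.BKᵀ) with hW₂
  have hYt : Yᵀ = Y := by
    simpa using (hS.dual.stationaryCov_posSemidef (dual_mem_stabilizing hK)).isHermitian.eq
  have hEs : ∀ s : ℝ, S.closedLoop (K + s • D) - S.closedLoop K = s • E := by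
    intro s
    simp only [Problem.closedLoop, hE, fromBlocks_sub_fromBlocks, Matrix.fromBlocks_smul]
    congr 1
    · simp
    · simp [Controller.CK, Matrix.mul_add]
    · simp [Controller.BK, Matrix.add_mul]
    · simp
  have hQs : ∀ s : ℝ, S.stateWeight (K + s • D) - S.stateWeight K = s • (Q₁ + s • Q₂) := by
    intro s
    simp only [Problem.stateWeight, hQ₁, hQ₂, fromBlocks_sub_fromBlocks, Matrix.fromBlocks_smul,
      Matrix.fromBlocks_add]
    congr 1
    · simp
    · simp
    · simp
    · simp only [Controller.CK, Prod.snd_add, Prod.smul_snd, Matrix.transpose_add,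
        Matrix.transpose_smul, Matrix.add_mul, Matrix.mul_add, Matrix.smul_mul, Matrix.mul_smul,
        smul_add, smul_smul]
      abel
  have hWs : ∀ s : ℝ, S.noiseIntensity (K + s • D) - S.noiseIntensity K = s • (W₁ + s • W₂) := by
    intro s
    simp only [Problem.noiseIntensity, hW₁, hW₂, fromBlocks_sub_fromBlocks, Matrix.fromBlocks_smul,
      Matrix.fromBlocks_add]
    congr 1
    · simp
    · simp
    · simp
    · simp only [Controller.BK, Prod.snd_add, Prod.fst_add, Prod.smul_snd, Prod.smul_fst,
        Matrix.transpose_add,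
        Matrix.transpose_smul, Matrix.add_mul, Matrix.mul_add, Matrix.smul_mul, Matrix.mul_smul,
        smul_add, smul_smul]
      abel
  have hX : Tendsto (fun s : ℝ => S.stationaryCov (K + s • D)) (𝓝 0) (𝓝 (S.stationaryCov K)) :=
    IsStable.tendsto_lyapunovSol hK (S.tendsto_closedLoop K D) (S.tendsto_noiseIntensity K D)
  have hst : ∀ᶠ s : ℝ in 𝓝 0, K + s • D ∈ S.stabilizing :=
    IsStable.eventually_isStable hK (S.tendsto_closedLoop K D)
  -- For small `s ≠ 0` the difference quotient of the cost equals `g s` at the perturbed covariance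
  -- exactly. By continuity its limit is `g 0` at the covariance of `K`, and stationarity makes this
  -- limit zero.
  let g : ℝ → Matrix (Fin n ⊕ Fin n) (Fin n ⊕ Fin n) ℝ → ℝ := fun s X =>
    ((Q₁ + s • Q₂) * X).trace + (Y * (W₁ + s • W₂)).trace + 2 * (E * X * Y).trace
  have hg : Continuous fun q : ℝ × Matrix (Fin n ⊕ Fin n) (Fin n ⊕ Fin n) ℝ => g q.1 q.2 := by
    have h1 : ∀ N₁ N₂ : Matrix (Fin n ⊕ Fin n) (Fin n ⊕ Fin n) ℝ,
        Continuous fun q : ℝ × Matrix (Fin n ⊕ Fin n) (Fin n ⊕ Fin n) ℝ => N₁ + q.1 • N₂ :=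
      fun N₁ N₂ => continuous_const.add (continuous_fst.smul continuous_const)
    exact ((((h1 Q₁ Q₂).matrix_mul continuous_snd).matrix_trace).add
      ((continuous_const.matrix_mul (h1 W₁ W₂)).matrix_trace)).add (continuous_const.mul
        ((continuous_const.matrix_mul continuous_snd).matrix_mul continuous_const).matrix_trace)
  have hlim : Tendsto (fun s : ℝ => g s (S.stationaryCov (K + s • D))) (𝓝[≠] 0)
      (𝓝 (g 0 (S.stationaryCov K))) :=
    ((hg.tendsto (0, S.stationaryCov K)).comp (tendsto_id.prodMk_nhds hX)).mono_left
      nhdsWithin_le_nhds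
  have hslope := tendsto_slope_of_hasFDerivAt_zero h D
  have heq : ∀ᶠ s : ℝ in 𝓝[≠] 0, s⁻¹ * (J (K + s • D) - J K)
      = g s (S.stationaryCov (K + s • D)) := by
    filter_upwards [hst.filter_mono nhdsWithin_le_nhds, self_mem_nhdsWithin] with s hs hs0
    have hs0' : s ≠ 0 := hs0
    have hXt : (S.stationaryCov (K + s • D))ᵀ = S.stationaryCov (K + s • D) := by
      simpa using (hS.stationaryCov_posSemidef hs).isHermitian.eq
    rw [hJ _ hs, hJ _ hK, Problem.stationaryCost, Problem.stationaryCost,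
      trace_lyapunov_sub (S.stationaryCov_spec hK) (S.stationaryCov_spec hs)
        (S.dual_stationaryCov_spec hK) hXt hYt, hEs, hQs, hWs]
    simp only [g, Matrix.smul_mul, Matrix.mul_smul, Matrix.trace_smul, smul_eq_mul]
    field_simp
    rfl
  have := tendsto_nhds_unique (hlim.congr' (heq.mono fun s hs => hs.symm)) hslope
  simpa [g] using this

/-- The block form of the stationarity conditions. -/
theorem Problem.IsMinimal.gradient_blocks {S : Problem n m p} (hS : S.IsMinimal)
    {K : Controller n m p} (hK : K ∈ S.stabilizing) {J : Controller n m p → ℝ}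
    (hJ : ∀ K' ∈ S.stabilizing, J K' = S.stationaryCost K')
    (h : HasFDerivAt J (0 : Controller n m p →L[ℝ] ℝ) K)
    {X₁₁ X₁₂ X₂₂ Y₁₁ Y₁₂ Y₂₂ : Matrix (Fin n) (Fin n) ℝ}
    (hX : S.stationaryCov K = Matrix.fromBlocks X₁₁ X₁₂ X₁₂ᵀ X₂₂)
    (hY : S.dual.stationaryCov (Controller.dual K) = Matrix.fromBlocks Y₁₁ Y₁₂ Y₁₂ᵀ Y₂₂)
    (hXt : X₂₂ᵀ = X₂₂) (hYt : Y₂₂ᵀ = Y₂₂) :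
    X₁₂ᵀ * Y₁₂ + X₂₂ * Y₂₂ = 0 ∧
    S.V * K.BKᵀ * Y₂₂ + S.C * (X₁₁ * Y₁₂ + X₁₂ * Y₂₂) = 0 ∧
    X₂₂ * K.CKᵀ * S.R + (X₁₂ᵀ * Y₁₁ + X₂₂ * Y₁₂ᵀ) * S.B = 0 := by
  have hVt : S.Vᵀ = S.V := by simpa using hS.V_pd.1.eq
  have hRt : S.Rᵀ = S.R := by simpa using hS.R_pd.1.eq
  have hg := hS.gradient_eq_zero hK hJ h
  rw [hX, hY] at hg
  refine ⟨?_, ?_, ?_⟩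
  -- Each equation comes from perturbing one controller matrix in an arbitrary direction `N`, since
  -- the trace pairing is nondegenerate. For `B_K` and `C_K` the two symmetric quadratic terms have
  -- equal traces, and the common factor `2` drops out.
  · rw [Matrix.ext_iff_trace_mul_left]
    intro N
    have := hg (N, 0, 0)
    simpa [Matrix.fromBlocks_multiply, trace_fromBlocks', Controller.AK, Controller.BK,
      Controller.CK, Matrix.mul_add, Matrix.mul_assoc] using this
  · rw [Matrix.ext_iff_trace_mul_left]
    intro N
    have h1 := hg (0, N, 0)
    simp only [Matrix.fromBlocks_multiply, trace_fromBlocks', Controller.AK, Controller.BK,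
      Controller.CK, Matrix.mul_assoc, Matrix.mul_zero, Matrix.zero_mul, add_zero, zero_add,
      Matrix.mul_add, Matrix.trace_add, Matrix.transpose_zero, Matrix.trace_zero] at h1
    have h2 : (Y₂₂ * (K.2.1 * (S.V * Nᵀ))).trace = (N * (S.V * (K.2.1ᵀ * Y₂₂))).trace := by
      rw [← Matrix.trace_transpose]
      simp only [Matrix.transpose_mul, Matrix.transpose_transpose, hVt, hYt, Matrix.mul_assoc]
    have h3 : (Y₂₂ * (N * (S.V * K.2.1ᵀ))).trace = (N * (S.V * (K.2.1ᵀ * Y₂₂))).trace := by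
      rw [Matrix.trace_mul_comm]
      simp only [Matrix.mul_assoc]
    rw [h2, h3] at h1
    simp only [Matrix.mul_assoc, Matrix.mul_add, Matrix.trace_add, Matrix.mul_zero,
      Matrix.trace_zero, Controller.BK]
    linarith
  · rw [Matrix.ext_iff_trace_mul_left]
    intro N
    have h1 := hg (0, 0, N)
    simp only [Matrix.fromBlocks_multiply, trace_fromBlocks', Controller.AK, Controller.BK,
      Controller.CK, Matrix.mul_assoc, Matrix.mul_zero, Matrix.zero_mul, add_zero, zero_add,
      Matrix.add_mul, Matrix.trace_add, Matrix.transpose_zero, Matrix.trace_zero] at h1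
    have h2 : (Nᵀ * (S.R * (K.2.2 * X₂₂))).trace = (N * (X₂₂ * (K.2.2ᵀ * S.R))).trace := by
      rw [← Matrix.trace_transpose, Matrix.trace_mul_comm]
      simp only [Matrix.transpose_mul, Matrix.transpose_transpose, hRt, hXt, Matrix.mul_assoc]
    have h3 : (K.2.2ᵀ * (S.R * (N * X₂₂))).trace = (N * (X₂₂ * (K.2.2ᵀ * S.R))).trace := by
      rw [← Matrix.mul_assoc, Matrix.trace_mul_comm]
      simp only [Matrix.mul_assoc]
    have h4 : ∀ Z : Matrix (Fin n) (Fin n) ℝ,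
        (S.B * (N * Z)).trace = (N * (Z * S.B)).trace := fun Z => by
      rw [Matrix.trace_mul_comm]
      simp only [Matrix.mul_assoc]
    rw [h2, h3, h4, h4] at h1
    simp only [Matrix.mul_assoc, Matrix.mul_add, Matrix.add_mul, Matrix.trace_add, Matrix.mul_zero,
      Matrix.trace_zero, Controller.CK] at h1 ⊢
    linarith

end Gradient

/-! ### Riccati form of a stationary point and global optimality -/

section GlobalOptimality

variable {n m p : ℕ}

/-- The block Lyapunov equation of a controller whose gains are built from the covariance blocks
reduces to the filter Riccati equation, and it determines the controller matrices. -/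
theorem Problem.IsMinimal.riccati_of_lyapunov {S : Problem n m p} (hS : S.IsMinimal)
    {K : Controller n m p} {X₁₁ X₂₂ F T P : Matrix (Fin n) (Fin n) ℝ}
    {G : Matrix (Fin m) (Fin n) ℝ} (hTF : T * F = 1) (hFT : F * T = 1) (hX₂₂ : X₂₂.PosDef)
    (hP : P = X₁₁ - F * X₂₂ * Fᵀ) (hPt : Pᵀ = P)
    (h : S.closedLoop K * Matrix.fromBlocks X₁₁ (-(F * X₂₂)) (-(F * X₂₂))ᵀ X₂₂
      + Matrix.fromBlocks X₁₁ (-(F * X₂₂)) (-(F * X₂₂))ᵀ X₂₂ * (S.closedLoop K)ᵀ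
      + S.noiseIntensity K = 0)
    (hC : K.CK = G * F) (hB : S.V * K.BKᵀ = -(S.C * P * Tᵀ)) :
    S.A * P + P * S.Aᵀ - P * S.Cᵀ * S.V⁻¹ * S.C * P + S.W = 0 ∧
      K.AK = T * (S.A - S.B * G - P * S.Cᵀ * S.V⁻¹ * S.C) * F ∧
      K.BK = -(T * (P * S.Cᵀ * S.V⁻¹)) := by
  have hVt : S.Vᵀ = S.V := by simpa using hS.V_pd.1.eq
  have hXt : X₂₂ᵀ = X₂₂ := by simpa using hX₂₂.1.eq
  have hVit : S.V⁻¹ᵀ = S.V⁻¹ := by rw [Matrix.transpose_nonsing_inv, hVt]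
  have hVi : S.V * S.V⁻¹ = 1 :=
    Matrix.mul_nonsing_inv _ ((Matrix.isUnit_iff_isUnit_det _).1 hS.V_pd.isUnit)
  have hXi : X₂₂ * X₂₂⁻¹ = 1 :=
    Matrix.mul_nonsing_inv _ ((Matrix.isUnit_iff_isUnit_det _).1 hX₂₂.isUnit)
  have hBV : K.BK * S.V = -(T * P * S.Cᵀ) := by
    have := congrArg Matrix.transpose hB
    simpa [Matrix.transpose_mul, hVt, hPt, Matrix.mul_assoc] using this
  set L := P * S.Cᵀ * S.V⁻¹ with hL
  have hBK : K.BK = -(T * L) := by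
    calc K.BK = K.BK * S.V * S.V⁻¹ := by rw [Matrix.mul_assoc, hVi, Matrix.mul_one]
      _ = -(T * L) := by rw [hBV, hL]; simp only [Matrix.neg_mul, Matrix.mul_assoc]
  have hLt : Lᵀ = S.V⁻¹ * S.C * P := by
    simp [hL, Matrix.transpose_mul, hPt, hVit, Matrix.mul_assoc]
  have hFTt : Tᵀ * Fᵀ = 1 := by rw [← Matrix.transpose_mul, hFT, Matrix.transpose_one]
  rw [Problem.closedLoop, Problem.noiseIntensity, Matrix.fromBlocks_transpose,
    Matrix.fromBlocks_multiply, Matrix.fromBlocks_multiply, Matrix.fromBlocks_add,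
    Matrix.fromBlocks_add, ← Matrix.fromBlocks_zero, Matrix.fromBlocks_inj] at h
  obtain ⟨h11, h12, -, h22⟩ := h
  have hXX : X₁₁ = P + F * X₂₂ * Fᵀ := by rw [hP, sub_add_cancel]
  have hTFl : ∀ {k : ℕ} (Z : Matrix (Fin n) (Fin k) ℝ), T * (F * Z) = Z := fun Z => by
    rw [← Matrix.mul_assoc, hTF, Matrix.one_mul]
  -- Add `T` times the `(1,2)` block to the `(2,2)` block: since `T X₁₂ = -X₂₂`, the terms in `A_Kᵀ`
  -- cancel, and so do those in `B_Kᵀ` by the formula for `B_K V`. What is left is an identity times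
  -- `X₂₂`, which is invertible.
  have hAK : K.AK = T * (S.A - S.B * G - L * S.C) * F := by
    have h1 := congrArg (T * ·) h12
    have h2 : K.BK * S.V * K.BKᵀ = -(T * P * S.Cᵀ) * K.BKᵀ := by rw [hBV]
    rw [h2, hBK] at h22
    simp only [hBK, hC, hXX] at h1
    have h3 : K.AK * X₂₂ = T * (S.A - S.B * G - L * S.C) * F * X₂₂ := by
      simp only [Matrix.transpose_mul, Matrix.transpose_neg, Matrix.mul_add, Matrix.add_mul,
        Matrix.mul_neg, Matrix.neg_mul, Matrix.mul_assoc, Matrix.mul_zero, add_zero, hTFl, hXt,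
        Matrix.mul_sub, Matrix.sub_mul] at h1 h22 ⊢
      linear_combination (norm := abel) h1 + h22
    calc K.AK = K.AK * X₂₂ * X₂₂⁻¹ := by rw [Matrix.mul_assoc, hXi, Matrix.mul_one]
      _ = _ := by rw [h3, Matrix.mul_assoc _ X₂₂, hXi, Matrix.mul_one]
  refine ⟨?_, hAK, hBK⟩
  -- Adding the `(1,2)` block times `Fᵀ` to the `(1,1)` block cancels every term with `X₂₂` or `G`
  -- and leaves the Riccati equation for `P`.
  have h1 := congrArg (· * Fᵀ) h12
  have h2 : P * S.Cᵀ * S.V⁻¹ * S.C * P = P * S.Cᵀ * Lᵀ := by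
    rw [hLt]; simp only [Matrix.mul_assoc]
  rw [← hL] at h2
  rw [h2]
  simp only [hAK, hBK, hC, hXX] at h1
  rw [hC, hXX] at h11
  simp only [Matrix.transpose_mul, Matrix.transpose_neg, Matrix.transpose_sub, Matrix.mul_add,
    Matrix.add_mul, Matrix.mul_neg, Matrix.neg_mul, Matrix.mul_assoc, Matrix.zero_mul, add_zero,
    hFTt, hXt, Matrix.mul_one, Matrix.mul_sub, Matrix.sub_mul] at h1 h11 ⊢
  linear_combination (norm := abel) h1 + h11

/-- Completion of squares: the stationary cost in terms of the control Riccati solution. -/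
theorem Problem.IsMinimal.stationaryCost_eq {S : Problem n m p} (hS : S.IsMinimal)
    {Y : Matrix (Fin n) (Fin n) ℝ} {G : Matrix (Fin m) (Fin n) ℝ} (hYt : Yᵀ = Y)
    (hY : S.Aᵀ * Y + Y * S.A - Y * S.B * S.R⁻¹ * S.Bᵀ * Y + S.Q = 0)
    (hG : G = S.R⁻¹ * S.Bᵀ * Y) {K : Controller n m p} (hK : K ∈ S.stabilizing) :
    S.stationaryCost K = (Y * S.W).trace
      + (S.R * (Matrix.fromCols G K.CK * S.stationaryCov K * (Matrix.fromCols G K.CK)ᵀ)).trace := by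
  have hRt : S.Rᵀ = S.R := by simpa using hS.R_pd.1.eq
  have hRi : S.R * S.R⁻¹ = 1 :=
    Matrix.mul_nonsing_inv _ ((Matrix.isUnit_iff_isUnit_det _).1 hS.R_pd.isUnit)
  have hRit : S.R⁻¹ᵀ = S.R⁻¹ := by rw [Matrix.transpose_nonsing_inv, hRt]
  have hRG : S.R * G = S.Bᵀ * Y := by
    rw [hG, Matrix.mul_assoc, ← Matrix.mul_assoc, hRi, Matrix.one_mul]
  have hGt : Gᵀ = Y * S.B * S.R⁻¹ := by
    simp [hG, Matrix.transpose_mul, hYt, hRit, Matrix.mul_assoc]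
  have hXt : (S.stationaryCov K)ᵀ = S.stationaryCov K := by
    simpa using (hS.stationaryCov_posSemidef hK).isHermitian.eq
  have hX := S.stationaryCov_spec hK
  rw [Problem.stationaryCost]
  rw [← Matrix.fromBlocks_toBlocks (S.stationaryCov K)] at hXt hX ⊢
  set X₁₁ := (S.stationaryCov K).toBlocks₁₁
  set X₁₂ := (S.stationaryCov K).toBlocks₁₂
  set X₂₁ := (S.stationaryCov K).toBlocks₂₁
  set X₂₂ := (S.stationaryCov K).toBlocks₂₂
  rw [Matrix.fromBlocks_transpose, Matrix.fromBlocks_inj] at hXt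
  obtain ⟨hX₁₁, hX₂₁, hX₁₂, -⟩ := hXt
  rw [Problem.closedLoop, Problem.noiseIntensity, Matrix.fromBlocks_transpose,
    Matrix.fromBlocks_multiply, Matrix.fromBlocks_multiply, Matrix.fromBlocks_add,
    Matrix.fromBlocks_add, ← Matrix.fromBlocks_zero, Matrix.fromBlocks_inj] at hX
  -- Pairing the plant block of the Lyapunov equation with `Y`, and the Riccati equation with `X₁₁`,
  -- produces the same `A` terms; eliminating them completes the square.
  have h11 := congrArg (fun Z => (Y * Z).trace) hX.1
  have hQ := congrArg (fun Z => (Z * X₁₁).trace) hY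
  have hGX : (S.R * (G * (X₁₁ * Gᵀ))).trace = (Y * S.B * S.R⁻¹ * S.Bᵀ * Y * X₁₁).trace := by
    rw [← Matrix.mul_assoc, ← Matrix.mul_assoc, Matrix.trace_mul_comm, hGt, hRG]
    simp only [Matrix.mul_assoc]
  have h12 : (S.R * (G * (X₁₂ * K.CKᵀ))).trace = (Y * (X₁₂ * (K.CKᵀ * S.Bᵀ))).trace := by
    rw [← Matrix.mul_assoc, hRG, Matrix.mul_assoc, Matrix.trace_mul_comm]
    simp only [Matrix.mul_assoc]
  have h21 : (S.R * (K.CK * (X₂₁ * Gᵀ))).trace = (Y * (S.B * (K.CK * X₂₁))).trace := by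
    have h1 : Gᵀ * S.R = Y * S.B := by
      have := congrArg Matrix.transpose hRG
      simpa [Matrix.transpose_mul, hRt, hYt] using this
    rw [Matrix.trace_mul_comm]
    simp only [Matrix.mul_assoc, h1]
    rw [← Matrix.mul_assoc, Matrix.trace_mul_comm]
    simp only [Matrix.mul_assoc]
  have h22 : (S.R * (K.CK * (X₂₂ * K.CKᵀ))).trace = (K.CKᵀ * (S.R * (K.CK * X₂₂))).trace := by
    rw [← Matrix.mul_assoc, ← Matrix.mul_assoc, Matrix.trace_mul_comm]
    simp only [Matrix.mul_assoc]
  have hA : (S.Aᵀ * (Y * X₁₁)).trace = (Y * (X₁₁ * S.Aᵀ)).trace := by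
    rw [Matrix.trace_mul_comm, Matrix.mul_assoc]
  rw [Problem.stateWeight, Matrix.fromBlocks_multiply, trace_fromBlocks',
    Matrix.fromCols_mul_fromBlocks, Matrix.transpose_fromCols, Matrix.fromCols_mul_fromRows]
  simp only [Matrix.mul_add, Matrix.add_mul, Matrix.sub_mul, Matrix.trace_add, Matrix.trace_sub,
    Matrix.mul_assoc, Matrix.zero_mul, Matrix.trace_zero, Matrix.mul_zero, add_zero, zero_add,
    Matrix.transpose_mul, hA] at h11 hQ hGX ⊢
  rw [hGX, h12, h21, h22]
  linarith

/-- The filter Riccati solution bounds the covariance of the plant state from below. -/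
theorem Problem.IsMinimal.stationaryCov_sub_posSemidef {S : Problem n m p} (hS : S.IsMinimal)
    {P : Matrix (Fin n) (Fin n) ℝ} (hPt : Pᵀ = P)
    (hP : S.A * P + P * S.Aᵀ - P * S.Cᵀ * S.V⁻¹ * S.C * P + S.W = 0)
    {K : Controller n m p} (hK : K ∈ S.stabilizing) :
    (S.stationaryCov K - Matrix.fromBlocks P 0 0 0).PosSemidef := by
  have hVt : S.Vᵀ = S.V := by simpa using hS.V_pd.1.eq
  have hVit : S.V⁻¹ᵀ = S.V⁻¹ := by rw [Matrix.transpose_nonsing_inv, hVt]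
  have hVi : S.V⁻¹ * S.V = 1 :=
    Matrix.nonsing_inv_mul _ ((Matrix.isUnit_iff_isUnit_det _).1 hS.V_pd.isUnit)
  set L := P * S.Cᵀ * S.V⁻¹ with hL
  have hLt : Lᵀ = S.V⁻¹ * S.C * P := by
    simp [hL, Matrix.transpose_mul, hPt, hVit, Matrix.mul_assoc]
  have hLV : L * S.V = P * S.Cᵀ := by rw [hL, Matrix.mul_assoc, hVi, Matrix.mul_one]
  have hVL : S.V * Lᵀ = S.C * P := by
    have := congrArg Matrix.transpose hLV
    simpa [Matrix.transpose_mul, hVt, hPt] using this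
  -- By the Riccati equation, inserting `diag(P, 0)` in the Lyapunov equation leaves exactly the
  -- residual `[L; B_K] V [L; B_K]ᵀ`. The difference `X - diag(P, 0)` thus solves a Lyapunov
  -- equation with this inhomogeneity.
  have hN : (Matrix.fromRows L K.BK * S.V * (Matrix.fromRows L K.BK)ᵀ).PosSemidef := by
    simpa using hS.V_pd.posSemidef.mul_mul_conjTranspose_same (Matrix.fromRows L K.BK)
  refine IsStable.posSemidef_of_lyapunov hK hN ?_
  have hX := S.stationaryCov_spec hK
  have h1 : Matrix.fromRows L K.BK * S.V * (Matrix.fromRows L K.BK)ᵀ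
      = Matrix.fromBlocks (P * S.Cᵀ * Lᵀ) (P * S.Cᵀ * K.BKᵀ) (K.BK * (S.C * P))
        (K.BK * S.V * K.BKᵀ) := by
    rw [Matrix.fromRows_mul, Matrix.transpose_fromRows, Matrix.fromRows_mul_fromCols, hLV,
      Matrix.mul_assoc K.BK S.V Lᵀ, hVL]
  have h2 : P * S.Cᵀ * Lᵀ = S.A * P + P * S.Aᵀ + S.W := by
    have : P * S.Cᵀ * S.V⁻¹ * S.C * P = P * S.Cᵀ * Lᵀ := by
      rw [hLt]; simp only [Matrix.mul_assoc]
    rw [← hL] at this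
    rw [this] at hP
    linear_combination (norm := abel) -hP
  have h3 : S.closedLoop K * Matrix.fromBlocks P 0 0 0
      + Matrix.fromBlocks P 0 0 0 * (S.closedLoop K)ᵀ + S.noiseIntensity K
      = Matrix.fromRows L K.BK * S.V * (Matrix.fromRows L K.BK)ᵀ := by
    rw [h1, h2, Problem.closedLoop, Problem.noiseIntensity, Matrix.fromBlocks_transpose,
      Matrix.fromBlocks_multiply, Matrix.fromBlocks_multiply, Matrix.fromBlocks_add,
      Matrix.fromBlocks_add]
    simp [Matrix.transpose_mul, Matrix.mul_assoc]
  rw [← h3, Matrix.mul_sub, Matrix.sub_mul]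
  linear_combination (norm := abel) hX

theorem posDef_toBlocks₂₂ {X : Matrix (Fin n ⊕ Fin n) (Fin n ⊕ Fin n) ℝ} (hX : X.PosDef) :
    X.toBlocks₂₂.PosDef :=
  hX.submatrix Sum.inr_injective

/-- Positive definite solutions of both Riccati equations, read off from a minimal stationary
point. -/
theorem Problem.IsMinimal.exists_riccati_of_stationary {S : Problem n m p} (hS : S.IsMinimal)
    {K : Controller n m p} (hK : K ∈ S.stabilizing) (hKmin : Controller.IsMinimal K)
    {J : Controller n m p → ℝ} (hJ : ∀ K' ∈ S.stabilizing, J K' = S.stationaryCost K')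
    (h : HasFDerivAt J (0 : Controller n m p →L[ℝ] ℝ) K) :
    ∃ P Y T F X₁₁ X₂₂ : Matrix (Fin n) (Fin n) ℝ, P.PosDef ∧ Y.PosDef ∧ T * F = 1 ∧
      S.A * P + P * S.Aᵀ - P * S.Cᵀ * S.V⁻¹ * S.C * P + S.W = 0 ∧
      S.Aᵀ * Y + Y * S.A - Y * S.B * S.R⁻¹ * S.Bᵀ * Y + S.Q = 0 ∧
      K.AK = T * (S.A - S.B * (S.R⁻¹ * S.Bᵀ * Y) - P * S.Cᵀ * S.V⁻¹ * S.C) * F ∧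
      K.BK = -(T * (P * S.Cᵀ * S.V⁻¹)) ∧ K.CK = S.R⁻¹ * S.Bᵀ * Y * F ∧
      X₂₂ᵀ = X₂₂ ∧ P = X₁₁ - F * X₂₂ * Fᵀ ∧
      S.stationaryCov K = Matrix.fromBlocks X₁₁ (-(F * X₂₂)) (-(F * X₂₂))ᵀ X₂₂ := by
  have hX := hS.stationaryCov_posDef hK hKmin.1
  have hY := hS.dual.stationaryCov_posDef (dual_mem_stabilizing hK) hKmin.dual.1
  have hXl := S.stationaryCov_spec hK
  have hYl := S.dual.stationaryCov_spec (dual_mem_stabilizing hK)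
  have key : ∀ {X : Matrix (Fin n ⊕ Fin n) (Fin n ⊕ Fin n) ℝ}, X.PosDef →
      ∃ X₁₁ X₁₂ X₂₂ : Matrix (Fin n) (Fin n) ℝ, X = Matrix.fromBlocks X₁₁ X₁₂ X₁₂ᵀ X₂₂ ∧
        X₂₂.PosDef ∧ X₂₂ᵀ = X₂₂ := by
    intro X hX
    have h22 := posDef_toBlocks₂₂ hX
    have hXt : Xᵀ = X := by simpa using hX.1.eq
    refine ⟨X.toBlocks₁₁, X.toBlocks₁₂, X.toBlocks₂₂, ?_, h22, by simpa using h22.1.eq⟩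
    have h21 : X.toBlocks₁₂ᵀ = X.toBlocks₂₁ := by
      ext i j
      exact congrFun (congrFun hXt (Sum.inr i)) (Sum.inl j)
    rw [h21, Matrix.fromBlocks_toBlocks]
  obtain ⟨X₁₁, X₁₂, X₂₂, hXb, hX₂₂, hX₂₂t⟩ := key hX
  obtain ⟨Y₁₁, Y₁₂, Y₂₂, hYb, hY₂₂, hY₂₂t⟩ := key hY
  obtain ⟨e1, e2, e3⟩ := hS.gradient_blocks hK hJ h hXb hYb hX₂₂t hY₂₂t
  have hXd := (Matrix.isUnit_iff_isUnit_det _).1 hX₂₂.isUnit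
  have hYd := (Matrix.isUnit_iff_isUnit_det _).1 hY₂₂.isUnit
  obtain ⟨T, hT⟩ : ∃ T, T = Y₂₂⁻¹ * Y₁₂ᵀ := ⟨_, rfl⟩
  obtain ⟨F, hF⟩ : ∃ F, F = -(X₁₂ * X₂₂⁻¹) := ⟨_, rfl⟩
  have hX₁₂ : X₁₂ = -(F * X₂₂) := by
    rw [hF, Matrix.neg_mul, neg_neg, Matrix.mul_assoc, Matrix.nonsing_inv_mul _ hXd, Matrix.mul_one]
  -- The two minus signs match the shape of `X₁₂ = -(F X₂₂)`: in the dual problem `-Tᵀ` plays the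
  -- role of `F`, and `-Fᵀ` that of `T`.
  have hY₁₂ : Y₁₂ = -(-Tᵀ * Y₂₂) := by
    rw [hT, Matrix.transpose_mul, Matrix.transpose_transpose, Matrix.transpose_nonsing_inv, hY₂₂t,
      Matrix.neg_mul, neg_neg, Matrix.mul_assoc, Matrix.nonsing_inv_mul _ hYd, Matrix.mul_one]
  -- The stationarity equation for `A_K` is `X₂₂ (1 - Fᵀ Tᵀ) Y₂₂ = 0`, and both outer factors are
  -- invertible.
  have hFT' : Fᵀ * Tᵀ = 1 := by
    have h1 : X₂₂ * (Fᵀ * Tᵀ) * Y₂₂ = X₂₂ * Y₂₂ := by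
      rw [hX₁₂, hY₁₂] at e1
      simp only [Matrix.transpose_neg, Matrix.transpose_mul, hX₂₂t, Matrix.neg_mul, neg_neg,
        Matrix.mul_assoc] at e1 ⊢
      linear_combination (norm := abel) -e1
    have h2 : X₂₂ * (Fᵀ * Tᵀ) = X₂₂ * 1 := by
      rw [Matrix.mul_one]
      exact hY₂₂.isUnit.mul_right_cancel h1
    exact hX₂₂.isUnit.mul_left_cancel h2
  have hTF : T * F = 1 := by
    rw [← Matrix.transpose_inj, Matrix.transpose_mul, hFT', Matrix.transpose_one]
  have hFT : F * T = 1 := mul_eq_one_comm.1 hTF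
  have hTF' : Tᵀ * Fᵀ = 1 := mul_eq_one_comm.1 hFT'
  rw [hX₁₂] at hXb
  rw [hY₁₂] at hYb
  have hP : (X₁₁ - F * X₂₂ * Fᵀ).PosDef := posDef_schur hX₂₂t (hXb ▸ hX)
  have hYP : (Y₁₁ - -Tᵀ * Y₂₂ * (-Tᵀ)ᵀ).PosDef := posDef_schur hY₂₂t (hYb ▸ hY)
  obtain ⟨P, hPd⟩ : ∃ P, P = X₁₁ - F * X₂₂ * Fᵀ := ⟨_, rfl⟩
  obtain ⟨Y, hYdef⟩ : ∃ Y, Y = Y₁₁ - -Tᵀ * Y₂₂ * (-Tᵀ)ᵀ := ⟨_, rfl⟩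
  rw [← hPd] at hP
  rw [← hYdef] at hYP
  have hPt : Pᵀ = P := by simpa using hP.1.eq
  have hYt : Yᵀ = Y := by simpa using hYP.1.eq
  -- Inserting `Fᵀ Tᵀ = 1` between `X₂₂` and `Y₂₂` assembles `P` and lets `Y₂₂` be cancelled on the
  -- right; `hC` does the same with `X₂₂` on the left.
  have hB : S.V * K.BKᵀ = -(S.C * P * Tᵀ) := by
    have h1 : (S.V * K.BKᵀ + S.C * P * Tᵀ) * Y₂₂ = 0 := by
      have h2 : F * (X₂₂ * Y₂₂) = F * (X₂₂ * (Fᵀ * (Tᵀ * Y₂₂))) := by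
        rw [← Matrix.mul_assoc Fᵀ, hFT', Matrix.one_mul]
      rw [hX₁₂, hY₁₂] at e2
      rw [hPd]
      simp only [Matrix.add_mul, Matrix.sub_mul, Matrix.mul_sub, Matrix.mul_add, Matrix.neg_mul,
        Matrix.mul_neg, neg_neg, Matrix.mul_assoc] at e2 ⊢
      rw [h2] at e2
      linear_combination (norm := abel) e2
    have h2 := congrArg (· * Y₂₂⁻¹) h1
    simp only [Matrix.mul_assoc _ Y₂₂, Matrix.mul_nonsing_inv _ hYd, Matrix.mul_one,
      Matrix.zero_mul] at h2
    exact eq_neg_of_add_eq_zero_left h2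
  have hC : K.CKᵀ * S.R = Fᵀ * Y * S.B := by
    have h1 : X₂₂ * (K.CKᵀ * S.R - Fᵀ * Y * S.B) = 0 := by
      have h2 : X₂₂ * (Y₂₂ * (T * S.B)) = X₂₂ * (Fᵀ * (Tᵀ * (Y₂₂ * (T * S.B)))) := by
        rw [← Matrix.mul_assoc Fᵀ, hFT', Matrix.one_mul]
      rw [hX₁₂, hY₁₂] at e3
      rw [hYdef]
      simp only [Matrix.add_mul, Matrix.sub_mul, Matrix.mul_sub, Matrix.neg_mul,
        Matrix.mul_neg, neg_neg, Matrix.mul_assoc, Matrix.transpose_neg, Matrix.transpose_mul,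
        Matrix.transpose_transpose, hX₂₂t, hY₂₂t] at e3 ⊢
      rw [h2] at e3
      linear_combination (norm := abel) e3
    have h2 := congrArg (X₂₂⁻¹ * ·) h1
    simp only [← Matrix.mul_assoc X₂₂⁻¹, Matrix.nonsing_inv_mul _ hXd, Matrix.one_mul,
      Matrix.mul_zero] at h2
    exact sub_eq_zero.1 h2
  have hRt : S.Rᵀ = S.R := by simpa using hS.R_pd.1.eq
  have hRi : S.R⁻¹ * S.R = 1 :=
    Matrix.nonsing_inv_mul _ ((Matrix.isUnit_iff_isUnit_det _).1 hS.R_pd.isUnit)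
  have hVt : S.Vᵀ = S.V := by simpa using hS.V_pd.1.eq
  have hVi : S.V⁻¹ * S.V = 1 :=
    Matrix.nonsing_inv_mul _ ((Matrix.isUnit_iff_isUnit_det _).1 hS.V_pd.isUnit)
  have hRC : S.R * K.CK = S.Bᵀ * Y * F := by
    have := congrArg Matrix.transpose hC
    simpa [Matrix.transpose_mul, hRt, hYt, Matrix.mul_assoc] using this
  have hCK : K.CK = S.R⁻¹ * S.Bᵀ * Y * F := by
    calc K.CK = S.R⁻¹ * (S.R * K.CK) := by rw [← Matrix.mul_assoc, hRi, Matrix.one_mul]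
      _ = _ := by rw [hRC]; simp only [Matrix.mul_assoc]
  have hBKt : K.BKᵀ = S.V⁻¹ * S.C * P * -Tᵀ := by
    calc K.BKᵀ = S.V⁻¹ * (S.V * K.BKᵀ) := by rw [← Matrix.mul_assoc, hVi, Matrix.one_mul]
      _ = _ := by rw [hB]; simp only [Matrix.mul_assoc, Matrix.mul_neg]
  rw [hXb] at hXl
  rw [hYb] at hYl
  obtain ⟨hRicc, hAK, hBK⟩ := hS.riccati_of_lyapunov hTF hFT hX₂₂ hPd hPt hXl hCK hB
  have hd := hS.dual.riccati_of_lyapunov (K := Controller.dual K) (F := -Tᵀ) (T := -Fᵀ)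
    (by simpa using hFT') (by simpa using hTF') hY₂₂ hYdef hYt hYl hBKt
    (by simpa [Problem.dual, Controller.dual, Controller.BK, Controller.CK] using hRC)
  refine ⟨P, Y, T, F, X₁₁, X₂₂, hP, hYP, hTF, hRicc, ?_, hAK, hBK, hCK, hX₂₂t, hPd, hXb⟩
  simpa [Problem.dual] using hd.1

/-- A minimal stationary point whose covariance is in Riccati form is globally optimal. -/
theorem Problem.IsMinimal.stationaryCost_le {S : Problem n m p} (hS : S.IsMinimal)
    {P Y F X₁₁ X₂₂ : Matrix (Fin n) (Fin n) ℝ} (hPt : Pᵀ = P) (hYt : Yᵀ = Y)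
    (hP : S.A * P + P * S.Aᵀ - P * S.Cᵀ * S.V⁻¹ * S.C * P + S.W = 0)
    (hY : S.Aᵀ * Y + Y * S.A - Y * S.B * S.R⁻¹ * S.Bᵀ * Y + S.Q = 0)
    {K : Controller n m p} (hK : K ∈ S.stabilizing) (hCK : K.CK = S.R⁻¹ * S.Bᵀ * Y * F)
    (hX₂₂ : X₂₂ᵀ = X₂₂) (hPX : P = X₁₁ - F * X₂₂ * Fᵀ)
    (hX : S.stationaryCov K = Matrix.fromBlocks X₁₁ (-(F * X₂₂)) (-(F * X₂₂))ᵀ X₂₂)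
    {K' : Controller n m p} (hK' : K' ∈ S.stabilizing) :
    S.stationaryCost K ≤ S.stationaryCost K' := by
  rw [hS.stationaryCost_eq hYt hY rfl hK, hS.stationaryCost_eq hYt hY rfl hK']
  set G := S.R⁻¹ * S.Bᵀ * Y
  -- The equality case: `[G, C_K] = G [1, F]` sees only the estimation error, whose covariance is
  -- `P`.
  have h1 : Matrix.fromCols G K.CK * S.stationaryCov K * (Matrix.fromCols G K.CK)ᵀ
      = G * P * Gᵀ := by
    have h2 : Matrix.fromCols G K.CK = G * Matrix.fromCols (1 : Matrix (Fin n) (Fin n) ℝ) F := by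
      rw [Matrix.mul_fromCols, Matrix.mul_one, hCK]
    rw [h2, hX, hPX, ← fromCols_one_mul_fromBlocks_mul F X₁₁ X₂₂ hX₂₂, Matrix.transpose_mul]
    simp only [Matrix.mul_assoc]
  have h2 : Matrix.fromCols G K'.CK *
      (Matrix.fromBlocks P 0 0 0 : Matrix (Fin n ⊕ Fin n) (Fin n ⊕ Fin n) ℝ) *
      (Matrix.fromCols G K'.CK)ᵀ
      = G * P * Gᵀ := by
    rw [Matrix.fromCols_mul_fromBlocks, Matrix.transpose_fromCols, Matrix.fromCols_mul_fromRows]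
    simp
  have h3 := hS.R_pd.posSemidef.trace_mul_nonneg
    ((hS.stationaryCov_sub_posSemidef hPt hP hK').mul_mul_conjTranspose_same
      (Matrix.fromCols G K'.CK))
  rw [Matrix.conjTranspose_eq_transpose_of_trivial, Matrix.mul_sub, Matrix.sub_mul, h2,
    Matrix.mul_sub, Matrix.trace_sub] at h3
  rw [h1]
  linarith

end GlobalOptimality

end LQG

theorem mainTheorem5 {n m p : ℕ} (S : LQG.Problem n m p) (hS : S.IsMinimal)
    {Ω : Type*} [MeasurableSpace Ω] (μ : Measure Ω) [IsProbabilityMeasure μ]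
    (w : ℝ≥0 → Ω → EuclideanSpace ℝ (Fin n)) (v : ℝ≥0 → Ω → EuclideanSpace ℝ (Fin p))
    (hw : LQG.IsBrownianWithIntensity w S.W μ) (hv : LQG.IsBrownianWithIntensity v S.V μ)
    (hwv : IndepFun (fun ω t => w t ω) (fun ω t => v t ω) μ)
    (x₀ ξ₀ : Ω → Fin n → ℝ) (hx₀ : MemLp x₀ 2 μ) (hξ₀ : MemLp ξ₀ 2 μ) :
    (∀ K ∈ S.stabilizing,
      (∀ T : ℝ, 0 < T → Integrable (S.pathCost w v x₀ ξ₀ K T) μ) ∧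
      Tendsto (S.averageCost μ w v x₀ ξ₀ K) atTop (𝓝 (S.cost μ w v x₀ ξ₀ K))) ∧
    ∀ K ∈ S.stabilizing, LQG.Controller.IsMinimal K →
      HasFDerivAt (S.cost μ w v x₀ ξ₀) (0 : LQG.Controller n m p →L[ℝ] ℝ) K →
      IsMinOn (S.cost μ w v x₀ ξ₀) S.stabilizing K ∧
      ∃ P Y T : Matrix (Fin n) (Fin n) ℝ,
        S.IsUniqueFilterSolution P ∧ S.IsUniqueControlSolution Y ∧ IsUnit T.det ∧
        ∃ (G : Matrix (Fin m) (Fin n) ℝ) (L : Matrix (Fin n) (Fin p) ℝ),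
          G = S.R⁻¹ * S.Bᵀ * Y ∧ L = P * S.Cᵀ * S.V⁻¹ ∧
          LQG.Controller.AK K = T * (S.A - S.B * G - L * S.C) * T⁻¹ ∧
          LQG.Controller.BK K = -(T * L) ∧
          LQG.Controller.CK K = G * T⁻¹ := by
  have hspec := fun K (hK : K ∈ S.stabilizing) => S.cost_spec hS hw hv hwv hx₀ hξ₀ hK
  -- Off the stabilizing set `limUnder` may take a default value. This does not affect the
  -- derivative at `K`, because stability is an open condition.
  have hcost : ∀ K ∈ S.stabilizing, S.cost μ w v x₀ ξ₀ K = S.stationaryCost K :=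
    fun K hK => (hspec K hK).2.limUnder_eq
  refine ⟨fun K hK => ⟨(hspec K hK).1, by rw [hcost K hK]; exact (hspec K hK).2⟩,
    fun K hK hKmin h => ?_⟩
  obtain ⟨P, Y, T, F, X₁₁, X₂₂, hP, hY, hTF, hPR, hYR, hAK, hBK, hCK, hX₂₂, hPX, hX⟩ :=
    hS.exists_riccati_of_stationary hK hKmin hcost h
  have hPt : Pᵀ = P := by simpa using hP.1.eq
  have hYt : Yᵀ = Y := by simpa using hY.1.eq
  have hTi : T⁻¹ = F := Matrix.inv_eq_right_inv hTF
  have hdual : ∀ Z : Matrix (Fin n) (Fin n) ℝ,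
      S.Aᵀ * Z + Z * S.A - Z * S.B * S.R⁻¹ * S.Bᵀ * Z + S.Q = 0 →
      S.dual.A * Z + Z * S.dual.Aᵀ - Z * S.dual.Cᵀ * S.dual.V⁻¹ * S.dual.C * Z + S.dual.W = 0 :=
    fun Z hZ => by simpa [LQG.Problem.dual] using hZ
  refine ⟨isMinOn_iff.2 fun K' hK' => ?_, P, Y, T,
    ⟨⟨hP, hPR⟩, fun P' hP' => hS.filterRiccati_unique hP hP'.1 hPR hP'.2⟩,
    ⟨⟨hY, hYR⟩, fun Y' hY' =>
      hS.dual.filterRiccati_unique hY hY'.1 (hdual Y hYR) (hdual Y' hY'.2)⟩,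
    Matrix.isUnit_det_of_right_inverse hTF, S.R⁻¹ * S.Bᵀ * Y, P * S.Cᵀ * S.V⁻¹, rfl, rfl, ?_,
    hBK, ?_⟩
  · rw [hcost K hK, hcost K' hK']
    exact hS.stationaryCost_le hPt hYt hPR hYR hK hCK hX₂₂ hPX hX hK'
  · rw [hTi]; exact hAK
  · rw [hTi]; exact hCK
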